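/- Let $n,k,M$ be positive integers. In the binary Hamming space $\mathbb{H}(n,2)=\{0,1\}^n$ put $\langle x,y\rangle = 1-2d(x,y)/n$, where $d$ is the Hamming distance. A $\tau$-design is a set $C\subset\mathbb{H}(n,2)$ with $|C|=\lambda 2^\tau$ for some integer $\lambda\ge 1$ such that, on every set of $\tau$ coordinates, every binary word of length $\tau$ is the restriction of exactly $\lambda$ elements of $C$. For $q=2$ the Rao bounds are $$R(n,2k)=\sum_{i=0}^{k}\binom{n}{i},\qquad R(n,2k+1)=2\sum_{i=0}^{k}\binom{n-1}{i}.$$ For $h:[-1,1)\to\mathbb{R}$ let $E(n,C;h)=\frac1{|C|}\sum_{x\ne y\in C}h(\langle x,y\rangle)$. Let $\mathcal L(n,M,2k;h)$ be the minimum of $E(n,C;h)$ over all $M$-point $2k$-designs $C\subset \mathbb{H}(n,2)$, and let $\ell=\ell(n,M,2k)$ be the minimum of $\langle x,y\rangle$ over all such designs $C$ and all distinct $x,y\in C$. Let $Q_i^{(n,2)}(t)=\binom{n}{i}^{-1}K_i^{(n,2)}\!\left(\tfrac{n(1-t)}2\right)$ with $K_i^{(n,2)}(z)=\sum_{j=0}^{i}(-1)^j\binom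 zj\binom{n-z}{i-j}$ be the normalized Krawtchouk polynomials, and for a polynomial $f=\sum_i f_iQ_i^{(n,2)}$ of degree at most $n$ let $f_0$ be the coefficient of $Q_0^{(n,2)}$. Assume that $R(n,2k)<M<R(n,2k+1)$, that there is an $M$-point $2k$-design in $\mathbb{H}(n,2)$, and that $h$ is absolutely monotone on $[-1,1)$ (that is, $h$ and all its derivatives exist and are nonnegative there). Then: 1. There are unique real numbers $-1=\beta_0<\beta_1<\dots<\beta_k<1$ and $\gamma_0,\dots,\gamma_k>0$ such that $f_0=\frac{f(1)}M+\sum_{i=0}^k\gamma_if(\beta_i)$ for every real polynomial $f$ of degree at most $2k$. 2. There is a unique real polynomial $G$ of degree at most $2k$ with $$G(\ell)=h(\ell),\qquad G(\beta_i)=h(\beta_i),\quad G'(\beta_i)=h'(\beta_i),\qquad i=1,\dots,k,$$ and it has a unique Krawtchouk expansion $G=\sum_{i=0}^{2k}G_iQ_i^{(n,2)}$. 3. We have $$\mathcal L(n,M,2k;h)\ \ge\ G_0M-G(1)\ \ge\ M\sum_{i=0}^k\gamma_ih(\beta_i),$$ and the last inequality is strict if $h$ is strictly absolutely monotone on $[-1,1)$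 (that is, $h$ and all its derivatives are positive there). -/

import Mathlib

open Polynomial

namespace HammingEnergy

/-- The binary Hamming space `H(n,2)`; its distance is Mathlib's `hammingDist`. -/
abbrev Cube (n : ℕ) : Type := Fin n → Fin 2

/-- The "inner product" `⟨x,y⟩ = 1 - 2 d(x,y) / n`. -/
noncomputable def ip {n : ℕ} (x y : Cube n) : ℝ :=
  1 - 2 * (hammingDist x y : ℝ) / (n : ℝ)

/-- `C` is a `τ`-design (an orthogonal array of strength `τ` and some index `lam ≥ 1`, without
repeated rows): `|C| = lam * 2 ^ τ`, and on every set `S` of `τ` coordinates every binary word is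
the restriction of exactly `lam` elements of `C`. -/
def IsDesign {n : ℕ} (τ : ℕ) (C : Finset (Cube n)) : Prop :=
  ∃ lam : ℕ, 0 < lam ∧ C.card = lam * 2 ^ τ ∧
    ∀ S : Finset (Fin n), S.card = τ → ∀ a : S → Fin 2,
      (C.filter (fun x => ∀ i : S, x i = a i)).card = lam

/-- The set of `M`-point `τ`-designs in `H(n,2)`. -/
def designs (n M τ : ℕ) : Set (Finset (Cube n)) :=
  {C | IsDesign τ C ∧ C.card = M}

/-- The `h`-energy `E(n,C;h) = |C|⁻¹ ∑_{x,y ∈ C, x ≠ y} h(⟨x,y⟩)`. -/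
noncomputable def energy {n : ℕ} (h : ℝ → ℝ) (C : Finset (Cube n)) : ℝ :=
  (1 / (C.card : ℝ)) * ∑ p ∈ C.offDiag, h (ip p.1 p.2)

/-- `𝓛(n,M,τ;h)`: the minimum energy of the `M`-point `τ`-designs in `H(n,2)`, equal to `+∞` if
there are none. -/
noncomputable def minDesignEnergy (n M τ : ℕ) (h : ℝ → ℝ) : EReal :=
  ⨅ C ∈ designs n M τ, (energy h C : EReal)

/-- `ℓ(C)`: the minimum of `⟨x,y⟩` over distinct `x, y ∈ C` (for `|C| ≥ 2`). -/
noncomputable def minIp {n : ℕ} (C : Finset (Cube n)) : ℝ :=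
  sInf {t : ℝ | ∃ x ∈ C, ∃ y ∈ C, x ≠ y ∧ t = ip x y}

/-- `ℓ(n,M,τ)`: the minimum of `ℓ(C)` over the `M`-point `τ`-designs `C` in `H(n,2)` (meaningful
when there is one and `M ≥ 2`). -/
noncomputable def designMinIp (n M τ : ℕ) : ℝ :=
  sInf (minIp '' designs n M τ)

/-- The Rao bound `R(n,τ)` for `q = 2`: `∑_{i ≤ k} (n choose i)` if `τ = 2k`, and
`2 ∑_{i ≤ k-1} (n-1 choose i)` if `τ = 2k-1`. -/
def rao (n τ : ℕ) : ℕ :=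
  if Even τ then ∑ i ∈ Finset.range (τ / 2 + 1), n.choose i
  else 2 * ∑ i ∈ Finset.range ((τ + 1) / 2), (n - 1).choose i

/-- The binomial coefficient `(p choose j) = p (p-1) ⋯ (p-j+1) / j!` of a polynomial `p`. -/
noncomputable def polyChoose (p : ℝ[X]) (j : ℕ) : ℝ[X] :=
  C (1 / (j.factorial : ℝ)) * ∏ m ∈ Finset.range j, (p - C (m : ℝ))

/-- The Krawtchouk polynomial `K_i^{(n,2)}(z) = ∑_j (-1)^j (z choose j) (n-z choose i-j)`. -/
noncomputable def kraw (n i : ℕ) : ℝ[X] :=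
  ∑ j ∈ Finset.range (i + 1),
    (-1) ^ j * polyChoose X j * polyChoose (C (n : ℝ) - X) (i - j)

/-- The normalized Krawtchouk polynomial `Q_i^{(n,2)}(t) = K_i^{(n,2)}(z) / (n choose i)`,
`z = n (1-t) / 2`. -/
noncomputable def normKraw (n i : ℕ) : ℝ[X] :=
  C (1 / (n.choose i : ℝ)) * (kraw n i).comp (C ((n : ℝ) / 2) * (1 - X))

/-- `c` is the list of coefficients of an expansion `f = ∑_{i=0}^{m} c_i Q_i^{(n,2)}`. -/
def IsKrawExpansion (n : ℕ) {m : ℕ} (f : ℝ[X]) (c : Fin (m + 1) → ℝ) : Prop :=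
  f = ∑ i : Fin (m + 1), C (c i) * normKraw n i

/-- The nodes `-1 = β_0 < β_1 < ⋯ < β_k < 1` and the weights `γ_0, …, γ_k > 0` satisfy
`f_0 = f(1) / M + ∑_{i=0}^{k} γ_i f(β_i)` for every real polynomial `f` of degree at most `2k`,
where `f_0` is the constant coefficient of the Krawtchouk expansion of `f`. -/
structure IsQuadrature (n M k : ℕ) (β γ : Fin (k + 1) → ℝ) : Prop where
  zero_node : β 0 = -1
  strictMono : StrictMono β
  lt_one : ∀ i, β i < 1
  weight_pos : ∀ i, 0 < γ i
  exact : ∀ (f : ℝ[X]) (c : Fin (2 * k + 1) → ℝ), f.natDegree ≤ 2 * k → IsKrawExpansion n f c →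
    c 0 = f.eval 1 / (M : ℝ) + ∑ i, γ i * f.eval (β i)

/-- `G` is a polynomial of degree at most `2k` with `G(l) = h(l)`, and `G(β_i) = h(β_i)`,
`G'(β_i) = h'(β_i)` for `i = 1, …, k`. -/
structure IsHermite {k : ℕ} (h : ℝ → ℝ) (l : ℝ) (β : Fin (k + 1) → ℝ) (G : ℝ[X]) : Prop where
  natDegree_le : G.natDegree ≤ 2 * k
  eval_left : G.eval l = h l
  eval_node : ∀ i : Fin k, G.eval (β i.succ) = h (β i.succ)
  deriv_node : ∀ i : Fin k, (derivative G).eval (β i.succ) = deriv h (β i.succ)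

/-- All derivatives of `h` (including `h` itself) exist and are positive on `s`. -/
def StrictlyAbsolutelyMonotoneOn (h : ℝ → ℝ) (s : Set ℝ) : Prop :=
  ContDiffOn ℝ (⊤ : ℕ∞) h s ∧ ∀ m : ℕ, ∀ t ∈ s, 0 < iteratedDerivWithin m h s t

end HammingEnergy

open HammingEnergy

namespace HammingEnergy

/-! Fix a point `x` of an `M`-point `2k`-design `D` and average `f(⟨x,y⟩)` over `y ≠ x`, dividing by
`M`. For `deg f ≤ 2k` the design property gives `f_0 - f(1)/M`, whatever `D` and `x` are
(`IsDesign.designFunctional_eq`). So the required quadrature is the Gauss-Radau rule, with fixed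
node `-1`, of a functional that is visibly positive. It is definite enough because a design with at
most `k` inner products from `x` would meet the Rao bound `R(n,2k)`
(`IsDesign.card_eq_rao_of_eval_eq_zero`).

The place of `ℓ` decides the signs. The quadrature forces an inner product below `β_1`, so `ℓ < β_1`
(`IsRadauRule.exists_ip_lt`); an antipodal pair would force `M ≥ R(n,2k+1)`, so `ℓ > -1`
(`IsDesign.rao_le_card_of_antipodal`). Hermite interpolation then has distinct nodes, and `h - G` is
a nonnegative multiple of `(t-ℓ) ∏ (t-β_i)^2` (`exists_hermite_error`). Hence `G ≤ h` on `[ℓ,1)`,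
which contains all inner products of the competing designs: this is the linear programming bound.
Also `G(-1) ≥ h(-1)`, while `G = h` at the other nodes, so the quadrature applied to `G` gives the
second inequality. -/

/-! ### Characters and the addition formula for Krawtchouk polynomials -/

/-- The character `x ↦ (-1) ^ (∑_{i ∈ S} x i)` of the binary Hamming space. -/
noncomputable def chi {n : ℕ} (S : Finset (Fin n)) (x : Cube n) : ℝ :=
  ∏ i ∈ S, (-1 : ℝ) ^ (x i : ℕ)

lemma chi_mul_self {n : ℕ} (S : Finset (Fin n)) (x : Cube n) : chi S x * chi S x = 1 := by
  rw [chi, ← Finset.prod_mul_distrib]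
  refine Finset.prod_eq_one fun i _ => ?_
  rw [← mul_pow]; norm_num

lemma chi_mul_chi {n : ℕ} (S T : Finset (Fin n)) (x : Cube n) :
    chi S x * chi T x = chi (symmDiff S T) x := by
  have h (A B : Finset (Fin n)) : chi A x = chi (A \ B) x * chi (A ∩ B) x := by
    rw [chi, ← Finset.prod_inter_mul_prod_sdiff A B, mul_comm]; rfl
  have hd : chi (symmDiff S T) x = chi (S \ T) x * chi (T \ S) x := by
    rw [chi, symmDiff_def, Finset.sup_eq_union, Finset.prod_union]
    · rfl
    · exact disjoint_sdiff_sdiff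
  rw [h S T, h T S, hd, Finset.inter_comm T S]
  linear_combination (chi (S \ T) x * chi (T \ S) x) * chi_mul_self (S ∩ T) x

lemma chi_mul_chi_same {n : ℕ} (S : Finset (Fin n)) (x y : Cube n) :
    chi S x * chi S y = ∏ i ∈ S, if x i = y i then (1 : ℝ) else -1 := by
  rw [chi, chi, ← Finset.prod_mul_distrib]
  refine Finset.prod_congr rfl fun i _ => ?_
  generalize x i = a
  generalize y i = b
  fin_cases a <;> fin_cases b <;> simp

lemma polyChoose_eval {p : ℝ[X]} {t : ℝ} {d : ℕ} (h : p.eval t = d) (j : ℕ) :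
    (polyChoose p j).eval t = d.choose j := by
  rw [polyChoose, eval_mul, eval_C, eval_prod]
  simp only [eval_sub, h, eval_C]
  rw [← descPochhammer_eval_eq_prod_range, descPochhammer_eval_eq_descFactorial,
    Nat.descFactorial_eq_factorial_mul_choose]
  push_cast
  field_simp

lemma prod_one_add_chi_X {n : ℕ} (x y : Cube n) :
    ∏ i : Fin n, (1 + C (if x i = y i then (1 : ℝ) else -1) * X) =
      (1 - X) ^ hammingDist x y * (1 + X) ^ (n - hammingDist x y) := by
  rw [← Finset.prod_filter_mul_prod_filter_not Finset.univ (fun i => x i ≠ y i)]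
  congr 1
  · rw [Finset.prod_congr rfl (g := fun _ => (1 - X : ℝ[X])), Finset.prod_const]
    · rfl
    · intro i hi
      rw [if_neg (Finset.mem_filter.1 hi).2]; simp [sub_eq_add_neg]
  · rw [Finset.prod_congr rfl (g := fun _ => (1 + X : ℝ[X])), Finset.prod_const]
    · congr 1
      have := Finset.card_filter_add_card_filter_not (s := (Finset.univ : Finset (Fin n)))
        (fun i => x i ≠ y i)
      simp only [Finset.card_univ, Fintype.card_fin] at this
      change _ = n - (Finset.univ.filter fun i => x i ≠ y i).card
      lia
    · intro i hi
      rw [if_pos (not_not.1 (Finset.mem_filter.1 hi).2)]; simp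

lemma coeff_one_sub_X_pow (d j : ℕ) : ((1 - X : ℝ[X]) ^ d).coeff j = (-1) ^ j * d.choose j := by
  have : (1 - X : ℝ[X]) = (1 + X : ℝ[X]).comp (C (-1) * X) := by simp [sub_eq_add_neg]
  rw [this, ← pow_comp, comp_C_mul_X_coeff, coeff_one_add_X_pow, mul_comm]

/-- Compare the coefficients of `X ^ i` in the generating function `prod_one_add_chi_X`: expanding
the product over coordinates gives the characters, expanding the two powers gives the Krawtchouk
sum. -/
lemma kraw_eval_hammingDist {n : ℕ} (i : ℕ) (x y : Cube n) :
    (kraw n i).eval (hammingDist x y : ℝ) =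
      ∑ S ∈ Finset.powersetCard i Finset.univ, chi S x * chi S y := by
  have hd : hammingDist x y ≤ n := by simpa using hammingDist_le_card_fintype (x := x) (y := y)
  have h1 : (∏ i : Fin n, (1 + C (if x i = y i then (1 : ℝ) else -1) * X)).coeff i =
      ∑ S ∈ Finset.powersetCard i Finset.univ, chi S x * chi S y := by
    rw [Finset.prod_one_add, finsetSum_coeff]
    simp only [Finset.prod_mul_distrib, Finset.prod_const, ← map_prod, coeff_C_mul, coeff_X_pow,
      ← chi_mul_chi_same, mul_ite, mul_one, mul_zero]
    rw [← Finset.sum_filter]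
    refine Finset.sum_congr ?_ fun _ _ => rfl
    ext S; simp [Finset.mem_powersetCard, eq_comm]
  rw [← h1, prod_one_add_chi_X, coeff_mul, Finset.Nat.sum_antidiagonal_eq_sum_range_succ_mk, kraw,
    eval_finsetSum]
  refine Finset.sum_congr rfl fun j _ => ?_
  rw [coeff_one_sub_X_pow, coeff_one_add_X_pow, eval_mul, eval_mul,
    polyChoose_eval (d := hammingDist x y) (by simp),
    polyChoose_eval (d := n - hammingDist x y) (by simp [Nat.cast_sub hd])]
  simp

lemma normKraw_eval_ip {n : ℕ} (hn : 0 < n) (i : ℕ) (x y : Cube n) :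
    (normKraw n i).eval (ip x y) = 1 / (n.choose i : ℝ) *
      ∑ S ∈ Finset.powersetCard i Finset.univ, chi S x * chi S y := by
  rw [normKraw, eval_mul, eval_C, eval_comp, ← kraw_eval_hammingDist]
  congr 2
  have : (n : ℝ) ≠ 0 := by positivity
  simp [ip]; field_simp

/-! ### Character sums over designs -/

lemma IsDesign.sum_restrict {n τ : ℕ} {D : Finset (Cube n)} (hD : IsDesign τ D)
    {T : Finset (Fin n)} (hT : T.card = τ) (g : (T → Fin 2) → ℝ) :
    ∃ lam : ℕ, ∑ x ∈ D, g (fun i => x i) = lam * ∑ a, g a := by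
  obtain ⟨lam, -, -, h⟩ := hD
  refine ⟨lam, ?_⟩
  rw [← Finset.sum_fiberwise D (fun x => fun i : T => x i), Finset.mul_sum]
  refine Finset.sum_congr rfl fun a _ => ?_
  rw [Finset.sum_congr rfl (g := fun _ => g a), Finset.sum_const, nsmul_eq_mul, ← h T hT a]
  · congr 3; ext x; simp [funext_iff]
  · intro x hx
    rw [(Finset.mem_filter.1 hx).2]

/-- After enlarging `S` to a set `T` of exactly `τ` coordinates, the sum over all words on `T`
factors over the coordinates, and a coordinate in `S` contributes `1 + (-1) = 0`. -/
lemma IsDesign.sum_chi {n τ : ℕ} {D : Finset (Cube n)} (hD : IsDesign τ D) (hτ : τ ≤ n)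
    {S : Finset (Fin n)} (hS : S.Nonempty) (hSτ : S.card ≤ τ) : ∑ x ∈ D, chi S x = 0 := by
  obtain ⟨T, hST, -, hT⟩ := Finset.exists_subsuperset_card_eq (Finset.subset_univ S) hSτ
    (by simpa using hτ)
  obtain ⟨lam, h⟩ := hD.sum_restrict hT
    (fun a => ∏ i : T, if (i : Fin n) ∈ S then (-1 : ℝ) ^ (a i : ℕ) else 1)
  have h1 (x : Cube n) :
      (∏ i : T, if (i : Fin n) ∈ S then (-1 : ℝ) ^ (x i : ℕ) else 1) = chi S x := by
    rw [Finset.prod_coe_sort T (fun i => if i ∈ S then (-1 : ℝ) ^ (x i : ℕ) else 1),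
      ← Finset.prod_filter, Finset.filter_mem_eq_inter, Finset.inter_eq_right.2 hST, chi]
  simp only [h1] at h
  obtain ⟨s, hs⟩ := hS
  rw [h, ← Fintype.prod_sum (fun (i : T) (b : Fin 2) =>
    if (i : Fin n) ∈ S then (-1 : ℝ) ^ (b : ℕ) else 1),
    Finset.prod_eq_zero (Finset.mem_univ ⟨s, hST hs⟩), mul_zero]
  simp [hs]

lemma IsDesign.sum_chi_mul_chi {n k : ℕ} {D : Finset (Cube n)} (hD : IsDesign (2 * k) D)
    (hk : 2 * k ≤ n) {S T : Finset (Fin n)} (hS : S.card ≤ k) (hT : T.card ≤ k) :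
    ∑ x ∈ D, chi S x * chi T x = if S = T then (D.card : ℝ) else 0 := by
  split_ifs with h
  · simp [h, chi_mul_self]
  · simp only [chi_mul_chi]
    refine hD.sum_chi hk ?_ ?_
    · rw [Finset.nonempty_iff_ne_empty]
      intro h0; exact h (symmDiff_eq_bot.1 h0)
    · refine (Finset.card_le_card (show symmDiff S T ⊆ S ∪ T from symmDiff_le_sup)).trans
        ((Finset.card_union_le S T).trans (by lia))

/-- Orthogonality of the characters of weight at most `k` kills the cross terms. Both Rao-type
arguments below come from it, with `a = 1` and with `a` the coefficients of a polynomial. -/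
lemma IsDesign.sum_sq {n k : ℕ} {D : Finset (Cube n)} (hD : IsDesign (2 * k) D)
    (hk : 2 * k ≤ n) (x : Cube n) {F : Finset (Finset (Fin n))} (hF : ∀ S ∈ F, S.card ≤ k)
    (a : Finset (Fin n) → ℝ) :
    ∑ y ∈ D, (∑ S ∈ F, chi S x * chi S y) * (∑ S ∈ F, a S * (chi S x * chi S y)) =
      D.card * ∑ S ∈ F, a S := by
  simp only [Finset.sum_mul_sum]
  rw [Finset.sum_comm, Finset.mul_sum]
  refine Finset.sum_congr rfl fun S hS => ?_
  rw [Finset.sum_comm, Finset.sum_eq_single S]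
  · have := hD.sum_chi_mul_chi hk (hF S hS) (hF S hS)
    rw [if_pos rfl] at this
    rw [← this, Finset.sum_mul]
    refine Finset.sum_congr rfl fun y _ => ?_
    linear_combination (a S * chi S y * chi S y) * chi_mul_self S x
  · intro T hT hTS
    have := hD.sum_chi_mul_chi hk (hF S hS) (hF T hT)
    rw [if_neg hTS.symm] at this
    rw [Finset.sum_congr rfl (g := fun y => (chi S x * (a T * chi T x)) * (chi S y * chi T y))
      (fun y _ => by ring), ← Finset.mul_sum, this, mul_zero]
  · intro h; exact absurd hS h

/-! ### Antipodal pairs and the odd Rao bound -/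

lemma chi_mul_chi_of_ip_eq_neg_one {n : ℕ} (hn : 0 < n) {x y : Cube n} (h : ip x y = -1)
    (S : Finset (Fin n)) : chi S x * chi S y = (-1) ^ S.card := by
  have hn' : (n : ℝ) ≠ 0 := by positivity
  have hd : hammingDist x y = n := by
    unfold ip at h; field_simp at h
    have : (hammingDist x y : ℝ) = n := by linarith
    exact_mod_cast this
  have hne (i : Fin n) : x i ≠ y i := by
    have : (Finset.univ.filter fun i => x i ≠ y i) = Finset.univ := by
      rw [← Finset.card_eq_iff_eq_univ]; simpa [hammingDist] using hd
    have := this ▸ Finset.mem_univ i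
    exact (Finset.mem_filter.1 this).2
  rw [chi_mul_chi_same, Finset.prod_congr rfl (g := fun _ => (-1 : ℝ)), Finset.prod_const]
  intro i _; rw [if_neg (hne i)]

/-- Pascal's rule splits each term on the left into two consecutive terms on the right, hence the
induction in steps of two. -/
lemma sum_choose_same_parity {n : ℕ} (k : ℕ) :
    ∑ i ∈ (Finset.range (k + 1)).filter (fun i => Even (i + k)), (n + 1).choose i =
      ∑ i ∈ Finset.range (k + 1), n.choose i := by
  induction k using Nat.twoStepInduction with
  | zero => simp [Finset.filter_singleton]
  | one =>
    simp [Finset.sum_filter, Finset.sum_range_succ, Nat.even_add_one]; lia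
  | more k ih _ =>
    rw [Finset.sum_filter] at ih ⊢
    rw [Finset.sum_range_succ, Finset.sum_range_succ, Finset.sum_range_succ _ (k + 2),
      Finset.sum_range_succ _ (k + 1), ← ih]
    have h1 : ¬ Even (k + 1 + (k + 2)) := by rw [Nat.not_even_iff_odd]; exact ⟨k + 1, by ring⟩
    have h2 : Even (k + 2 + (k + 2)) := ⟨k + 2, rfl⟩
    simp only [h1, h2, if_true, if_false, Nat.even_add, even_two, iff_true,
      Nat.choose_succ_succ' n (k + 1)]
    ring

/-- A `2k`-design with an antipodal pair has at least `R(n, 2k+1)` points. -/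
lemma IsDesign.rao_le_card_of_antipodal {n k : ℕ} (hn : 0 < n) {D : Finset (Cube n)}
    (hD : IsDesign (2 * k) D) (hk : 2 * k ≤ n) {x y : Cube n} (hx : x ∈ D) (hy : y ∈ D)
    (hxy : ip x y = -1) : rao n (2 * k + 1) ≤ D.card := by
  classical
  have hne : x ≠ y := by rintro rfl; norm_num [ip] at hxy
  -- With all sizes of the parity of `k`, the kernel `∑ S ∈ F, chi S x * chi S z` has the extreme
  -- absolute value `|F|` at both `z = x` and its antipode `z = y`.
  set F : Finset (Finset (Fin n)) :=
    Finset.univ.filter fun S => S.card ≤ k ∧ Even (S.card + k) with hFdef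
  have hF : ∀ S ∈ F, S.card ≤ k := fun S hS => (Finset.mem_filter.1 hS).2.1
  have hcard : 2 * F.card = rao n (2 * k + 1) := by
    have h1 : ¬ Even (2 * k + 1) := by simp
    obtain ⟨m, rfl⟩ : ∃ m, n = m + 1 := ⟨n - 1, by lia⟩
    rw [rao, if_neg h1, show (2 * k + 1 + 1) / 2 = k + 1 by lia, Nat.add_sub_cancel,
      ← sum_choose_same_parity]
    congr 1
    rw [Finset.card_eq_sum_card_fiberwise (f := Finset.card)
      (t := (Finset.range (k + 1)).filter (fun i => Even (i + k)))]
    · refine Finset.sum_congr rfl fun i hi => ?_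
      have := Finset.card_powersetCard i (Finset.univ : Finset (Fin (m + 1)))
      rw [Finset.card_univ, Fintype.card_fin] at this
      rw [← this]
      congr 1
      ext S
      simp only [Finset.mem_filter, Finset.mem_range] at hi
      simp only [hFdef, Finset.mem_filter, Finset.mem_univ, true_and, Finset.mem_powersetCard,
        Finset.subset_univ]
      constructor
      · exact fun h => h.2
      · rintro rfl; exact ⟨⟨by lia, hi.2⟩, rfl⟩
    · intro S hS
      have := (Finset.mem_filter.1 hS).2
      simp only [Finset.coe_filter, Finset.mem_range, Set.mem_ofPred_eq]
      exact ⟨by lia, this.2⟩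
  have hs := hD.sum_sq hk x hF (fun _ => 1)
  simp only [one_mul, Finset.sum_const, nsmul_eq_mul, mul_one] at hs
  -- Keeping only these two points in the sum of squares gives `2 |F|^2 ≤ |D| |F|`.
  have hle : ∑ z ∈ ({x, y} : Finset (Cube n)),
      (∑ S ∈ F, chi S x * chi S z) * (∑ S ∈ F, chi S x * chi S z) ≤ D.card * F.card := by
    rw [← hs]
    refine Finset.sum_le_sum_of_subset_of_nonneg ?_ fun z _ _ => mul_self_nonneg _
    intro z hz
    rcases Finset.mem_insert.1 hz with rfl | hz
    · exact hx
    · rwa [Finset.mem_singleton.1 hz]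
  have h1 : ∑ S ∈ F, chi S x * chi S x = F.card := by simp [chi_mul_self]
  have h2 : ∑ S ∈ F, chi S x * chi S y = (-1) ^ k * F.card := by
    rw [Finset.sum_congr rfl (g := fun _ => (-1 : ℝ) ^ k), Finset.sum_const, nsmul_eq_mul, mul_comm]
    intro S hS
    rw [chi_mul_chi_of_ip_eq_neg_one hn hxy]
    have := (Finset.mem_filter.1 hS).2.2
    rcases Nat.even_or_odd k with hk' | hk'
    · rw [hk'.neg_one_pow, (Nat.even_add.1 this |>.2 hk').neg_one_pow]
    · have h3 : Odd S.card := by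
        rw [← Nat.not_even_iff_odd] at hk' ⊢
        exact fun h => hk' (Nat.even_add.1 this |>.1 h)
      rw [hk'.neg_one_pow, h3.neg_one_pow]
  rw [Finset.sum_pair hne, h1, h2] at hle
  have h3 : ((-1 : ℝ) ^ k) * (-1) ^ k = 1 := by rw [← mul_pow]; norm_num
  have hFpos : 0 < F.card := by
    have : 0 < rao n (2 * k + 1) := by
      have h1 : ¬ Even (2 * k + 1) := by simp
      rw [rao, if_neg h1, show (2 * k + 1 + 1) / 2 = k + 1 by lia, Finset.sum_range_succ']
      simp
    lia
  have h4 : (F.card : ℝ) * (2 * F.card) ≤ F.card * D.card := by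
    linear_combination hle - (F.card : ℝ) ^ 2 * h3
  have h5 : (2 * F.card : ℝ) ≤ D.card := le_of_mul_le_mul_left h4 (by exact_mod_cast hFpos)
  rw [← hcard]; exact_mod_cast h5

/-! ### Krawtchouk expansions -/

lemma mem_degreeLT_succ {m : ℕ} {p : ℝ[X]} : p ∈ degreeLT ℝ (m + 1) ↔ p.natDegree ≤ m := by
  rw [mem_degreeLT, degree_lt_iff_coeff_zero, natDegree_le_iff_coeff_eq_zero]; rfl

lemma natDegree_polyChoose_le {p : ℝ[X]} (hp : p.natDegree ≤ 1) (j : ℕ) :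
    (polyChoose p j).natDegree ≤ j := by
  refine (natDegree_C_mul_le _ _).trans ((natDegree_prod_le _ _).trans ?_)
  refine (Finset.sum_le_card_nsmul _ _ 1 fun m _ => ?_).trans (by simp)
  exact (natDegree_sub_le_of_le hp (natDegree_C _).le).trans (by simp)

lemma coeff_polyChoose {p : ℝ[X]} (hp : p.natDegree ≤ 1) (j : ℕ) :
    (polyChoose p j).coeff j = 1 / (j.factorial : ℝ) * p.coeff 1 ^ j := by
  have := coeff_prod_of_natDegree_le (Finset.range j) (fun m => p - C (m : ℝ)) 1
    (fun m _ => (natDegree_sub_le_of_le hp (natDegree_C _).le).trans (by simp))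
  rw [Finset.card_range, mul_one] at this
  rw [polyChoose, coeff_C_mul, this]
  simp

lemma natDegree_const_sub_X_le (a : ℝ) : (C a - X : ℝ[X]).natDegree ≤ 1 :=
  natDegree_sub_le_of_le (natDegree_C a).le natDegree_X_le |>.trans (by simp)

lemma natDegree_kraw_le (n i : ℕ) : (kraw n i).natDegree ≤ i := by
  refine natDegree_sum_le_of_forall_le _ _ fun j hj => ?_
  have hj' : j ≤ i := by simpa [Nat.lt_succ_iff] using hj
  refine (natDegree_mul_le_of_le (natDegree_mul_le_of_le (m := 0) ?_
    (natDegree_polyChoose_le (by simp) j))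
    (natDegree_polyChoose_le (natDegree_const_sub_X_le _) (i - j))).trans (by lia)
  exact natDegree_pow_le_of_le j (by simp : (-1 : ℝ[X]).natDegree ≤ 0)

/-- No cancellation occurs: in the `j`-th term the explicit sign `(-1)^j` combines with `(-1)^(i-j)`
from the leading coefficient of the second binomial, so every term has sign `(-1)^i`. -/
lemma coeff_kraw_ne_zero (n i : ℕ) : (kraw n i).coeff i ≠ 0 := by
  have key : (kraw n i).coeff i = (-1) ^ i * ∑ j ∈ Finset.range (i + 1),
      1 / (j.factorial : ℝ) * (1 / ((i - j).factorial : ℝ)) := by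
    rw [kraw, finsetSum_coeff, Finset.mul_sum]
    refine Finset.sum_congr rfl fun j hj => ?_
    have hj' : j ≤ i := by simpa [Nat.lt_succ_iff] using hj
    have h := coeff_mul_add_eq_of_natDegree_le
      (natDegree_polyChoose_le (p := X) (by simp) j)
      (natDegree_polyChoose_le (natDegree_const_sub_X_le (n : ℝ)) (i - j))
    rw [Nat.add_sub_cancel' hj', coeff_polyChoose (by simp),
      coeff_polyChoose (natDegree_const_sub_X_le _)] at h
    rw [mul_assoc, show ((-1 : ℝ[X]) ^ j) = C ((-1) ^ j) by simp, coeff_C_mul, h]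
    have h2 : (-1 : ℝ) ^ i = (-1) ^ j * (-1) ^ (i - j) := by
      rw [← pow_add, Nat.add_sub_cancel' hj']
    rw [h2]
    simp [coeff_X]
    ring
  rw [key]
  refine mul_ne_zero (pow_ne_zero _ (by norm_num)) (ne_of_gt ?_)
  exact Finset.sum_pos (fun j _ => by positivity) (by simp)

lemma natDegree_normKraw {n i : ℕ} (hn : 0 < n) (hi : i ≤ n) : (normKraw n i).natDegree = i := by
  have hk : (kraw n i).natDegree = i :=
    le_antisymm (natDegree_kraw_le n i) (le_natDegree_of_ne_zero (coeff_kraw_ne_zero n i))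
  have hn' : (n : ℝ) ≠ 0 := by positivity
  have h1 : (1 - X : ℝ[X]).natDegree = 1 := by
    rw [← natDegree_neg, neg_sub]; exact natDegree_X_sub_C 1
  have hb : (n.choose i : ℝ) ≠ 0 := by exact_mod_cast (Nat.choose_pos hi).ne'
  rw [normKraw, natDegree_C_mul (by positivity), natDegree_comp, hk,
    natDegree_C_mul (by positivity), h1, mul_one]

lemma exists_isKrawExpansion {n : ℕ} (hn : 0 < n) (m : ℕ) (hm : m ≤ n) (f : ℝ[X])
    (hf : f.natDegree ≤ m) : ∃ c : Fin (m + 1) → ℝ, IsKrawExpansion n f c := by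
  induction m generalizing f with
  | zero =>
    have h0 : (normKraw n 0).natDegree = 0 := natDegree_normKraw hn hm
    have hne : (normKraw n 0).coeff 0 ≠ 0 := by
      simp [normKraw, kraw, polyChoose, coeff_zero_eq_eval_zero]
    refine ⟨fun _ => f.coeff 0 / (normKraw n 0).coeff 0, ?_⟩
    have h1 : ∑ i : Fin (0 + 1), C (f.coeff 0 / (normKraw n 0).coeff 0) * normKraw n i =
        C (f.coeff 0 / (normKraw n 0).coeff 0) * normKraw n 0 := by simp
    rw [IsKrawExpansion, h1, eq_C_of_natDegree_le_zero h0.le, ← C_mul, coeff_C_zero,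
      div_mul_cancel₀ _ hne]
    exact eq_C_of_natDegree_le_zero hf
  | succ m ih =>
    have hd := natDegree_normKraw hn hm
    have hne : (normKraw n (m + 1)).coeff (m + 1) ≠ 0 := by
      nth_rw 2 [← hd]
      rw [coeff_natDegree, leadingCoeff_ne_zero]
      rintro h; rw [h] at hd; simp at hd
    set a := f.coeff (m + 1) / (normKraw n (m + 1)).coeff (m + 1) with ha
    obtain ⟨c, hc⟩ := ih (by lia) (f - C a * normKraw n (m + 1)) (by
      rw [natDegree_le_iff_coeff_eq_zero]
      intro N hN
      rcases eq_or_lt_of_le (Nat.succ_le_of_lt hN) with h | h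
      · rw [← h, coeff_sub, coeff_C_mul, ha, Nat.succ_eq_add_one, div_mul_cancel₀ _ hne, sub_self]
      · rw [coeff_sub, coeff_C_mul, coeff_eq_zero_of_natDegree_lt (by lia),
          coeff_eq_zero_of_natDegree_lt (by lia)]; simp)
    refine ⟨Fin.snoc c a, ?_⟩
    rw [IsKrawExpansion, Fin.sum_univ_castSucc]
    simp only [Fin.snoc_castSucc, Fin.snoc_last, Fin.val_castSucc, Fin.val_last]
    rw [IsKrawExpansion] at hc
    rw [← hc, sub_add_cancel]

/-- Existence makes the coefficient map surjective between spaces of dimension `m + 1`, hence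
injective. -/
lemma existsUnique_isKrawExpansion {n : ℕ} (hn : 0 < n) {m : ℕ} (hm : m ≤ n) {f : ℝ[X]}
    (hf : f.natDegree ≤ m) : ∃! c : Fin (m + 1) → ℝ, IsKrawExpansion n f c := by
  let φ : (Fin (m + 1) → ℝ) →ₗ[ℝ] degreeLT ℝ (m + 1) :=
    { toFun := fun c => ⟨∑ i : Fin (m + 1), C (c i) * normKraw n i, by
        refine Submodule.sum_mem _ fun i _ => ?_
        rw [mem_degreeLT_succ]
        refine (natDegree_C_mul_le _ _).trans ?_
        rw [natDegree_normKraw hn (by lia)]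
        lia⟩
      map_add' := fun c d => by
        ext1; simp [add_mul, Finset.sum_add_distrib]
      map_smul' := fun r c => by
        ext1; simp [Finset.smul_sum, smul_eq_C_mul, mul_assoc] }
  have hsurj : Function.Surjective φ := by
    rintro ⟨g, hg⟩
    obtain ⟨c, hc⟩ := exists_isKrawExpansion hn m hm g
      (mem_degreeLT_succ.1 hg)
    exact ⟨c, Subtype.ext hc.symm⟩
  have hinj : Function.Injective φ :=
    (LinearMap.injective_iff_surjective_of_finrank_eq_finrank
      (by rw [(degreeLTEquiv ℝ (m + 1)).finrank_eq])).2 hsurj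
  obtain ⟨c, hc⟩ := exists_isKrawExpansion hn m hm f hf
  refine ⟨c, hc, fun d hd => hinj (Subtype.ext ?_)⟩
  exact (hd.symm.trans hc : _)

/-! ### Polynomial averages over designs and equality in the even Rao bound -/

lemma ip_self {n : ℕ} (x : Cube n) : ip x x = 1 := by simp [ip]

lemma ip_mem_Ico {n : ℕ} {x y : Cube n} (hxy : x ≠ y) : ip x y ∈ Set.Ico (-1 : ℝ) 1 := by
  have hd : hammingDist x y ≤ n := by simpa using hammingDist_le_card_fintype (x := x) (y := y)
  have hd0 : 0 < hammingDist x y := hammingDist_pos.2 hxy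
  have hd' : (hammingDist x y : ℝ) ≤ n := by exact_mod_cast hd
  have hd0' : (0 : ℝ) < hammingDist x y := by exact_mod_cast hd0
  have hn : (0 : ℝ) < n := hd0'.trans_le hd'
  have h1 : 2 * (hammingDist x y : ℝ) / n ≤ 2 := by rw [div_le_iff₀ hn]; linarith
  have h2 : 0 < 2 * (hammingDist x y : ℝ) / n := by positivity
  constructor <;> unfold ip <;> linarith

lemma IsKrawExpansion.eval_ip {n m : ℕ} (hn : 0 < n) {f : ℝ[X]} {c : Fin (m + 1) → ℝ}
    (hf : IsKrawExpansion n f c) (x y : Cube n) :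
    f.eval (ip x y) = ∑ i : Fin (m + 1), ∑ S ∈ Finset.powersetCard i Finset.univ,
      c i / n.choose i * (chi S x * chi S y) := by
  rw [hf, eval_finsetSum]
  refine Finset.sum_congr rfl fun i _ => ?_
  rw [eval_mul, eval_C, normKraw_eval_ip hn, ← Finset.mul_sum]
  ring

lemma IsDesign.sum_eval_ip {n τ : ℕ} (hn : 0 < n) (hτ : τ ≤ n) {D : Finset (Cube n)}
    (hD : IsDesign τ D) (x : Cube n) {f : ℝ[X]} {c : Fin (τ + 1) → ℝ}
    (hf : IsKrawExpansion n f c) : ∑ y ∈ D, f.eval (ip x y) = c 0 * D.card := by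
  simp only [hf.eval_ip hn]
  rw [Finset.sum_comm, Finset.sum_eq_single_of_mem 0 (Finset.mem_univ _)]
  · have h0 (y : Cube n) : ∑ S ∈ Finset.powersetCard ((0 : Fin (τ + 1)) : ℕ) Finset.univ,
        c 0 / (n.choose ((0 : Fin (τ + 1)) : ℕ)) * (chi S x * chi S y) = c 0 := by
      rw [Fin.val_zero, Finset.powersetCard_zero, Finset.sum_singleton]
      simp [chi]
    rw [Finset.sum_congr rfl fun y _ => h0 y, Finset.sum_const, nsmul_eq_mul, mul_comm]
  · intro i _ hi
    rw [Finset.sum_comm]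
    refine Finset.sum_eq_zero fun S hS => ?_
    have hSc := (Finset.mem_powersetCard.1 hS).2
    have hi0 : (i : ℕ) ≠ 0 := Fin.val_ne_zero_iff.2 hi
    rw [← Finset.mul_sum, ← Finset.mul_sum,
      hD.sum_chi hτ (Finset.card_pos.1 (by lia)) (by lia), mul_zero, mul_zero]

lemma rao_two_mul (n k : ℕ) :
    rao n (2 * k) = (Finset.univ.filter fun S : Finset (Fin n) => S.card ≤ k).card := by
  rw [rao, if_pos (even_two_mul k), Nat.mul_div_cancel_left k two_pos,
    Finset.card_eq_sum_card_fiberwise (f := Finset.card) (t := Finset.range (k + 1))]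
  · refine Finset.sum_congr rfl fun i hi => ?_
    have := Finset.card_powersetCard i (Finset.univ : Finset (Fin n))
    rw [Finset.card_univ, Fintype.card_fin] at this
    rw [← this]
    congr 1
    ext S
    have := Finset.mem_range.1 hi
    simp only [Finset.mem_filter, Finset.mem_univ, true_and, Finset.mem_powersetCard,
      Finset.subset_univ]
    lia
  · intro S hS
    have := (Finset.mem_filter.1 hS).2
    simp only [Finset.coe_range, Set.mem_Iio]
    lia

/-- If a polynomial of degree at most `k` vanishes at all the inner products of a point of a
`2k`-design with the other points, but not at `1`, then the design attains the Rao bound. -/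
lemma IsDesign.card_eq_rao_of_eval_eq_zero {n k : ℕ} (hn : 0 < n) (hk : 2 * k ≤ n)
    {D : Finset (Cube n)} (hD : IsDesign (2 * k) D) {x : Cube n} (hx : x ∈ D) {q : ℝ[X]}
    (hq : q.natDegree ≤ k) (hq1 : q.eval 1 ≠ 0) (h0 : ∀ y ∈ D, y ≠ x → q.eval (ip x y) = 0) :
    D.card = rao n (2 * k) := by
  obtain ⟨c, hc⟩ := exists_isKrawExpansion hn k (by lia) q hq
  set F : Finset (Finset (Fin n)) := Finset.univ.filter fun S => S.card ≤ k with hFdef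
  have hF : ∀ S ∈ F, S.card ≤ k := fun S hS => (Finset.mem_filter.1 hS).2
  -- The reduction modulo `k + 1` in `Fin.ofNat` is harmless, as `|S| ≤ k` on `F`.
  set a : Finset (Fin n) → ℝ := fun S => c (Fin.ofNat (k + 1) S.card) / n.choose S.card with ha
  have hqe (y : Cube n) : q.eval (ip x y) = ∑ S ∈ F, a S * (chi S x * chi S y) := by
    rw [hc.eval_ip hn, ← Finset.sum_fiberwise_of_maps_to (t := Finset.univ)
      (g := fun S : Finset (Fin n) => Fin.ofNat (k + 1) S.card) (fun _ _ => Finset.mem_univ _)]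
    refine Finset.sum_congr rfl fun i _ => ?_
    refine Finset.sum_congr ?_ fun S hS => ?_
    · ext S
      simp only [hFdef, Finset.mem_filter, Finset.mem_univ, true_and, Finset.mem_powersetCard,
        Finset.subset_univ, Fin.ext_iff, Fin.val_ofNat]
      constructor
      · intro h
        exact ⟨by lia, by rw [Nat.mod_eq_of_lt (by lia)]; exact h⟩
      · rintro ⟨h1, h2⟩
        rwa [Nat.mod_eq_of_lt (by lia)] at h2
    · have h1 := (Finset.mem_filter.1 hS).2
      have h2 := hF S (Finset.mem_filter.1 hS).1
      have h3 : (i : ℕ) = S.card := by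
        rw [← h1, Fin.val_ofNat, Nat.mod_eq_of_lt (by lia)]
      simp only [ha]
      rw [h1, h3]
  -- By `h0` only `y = x` survives on the left, which leaves `|F| q(1) = |D| q(1)`.
  have hs := hD.sum_sq hk x hF a
  simp only [← hqe] at hs
  rw [Finset.sum_eq_single x (fun y hy hyx => by rw [h0 y hy hyx, mul_zero])
    (fun h => absurd hx h)] at hs
  have hq1' : ∑ S ∈ F, a S = q.eval 1 := by
    rw [← ip_self x, hqe]; simp [chi_mul_self]
  rw [hq1', ip_self] at hs
  have := mul_right_cancel₀ hq1 hs
  rw [rao_two_mul]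
  simp only [chi_mul_self, Finset.sum_const, nsmul_eq_mul, mul_one] at this
  exact_mod_cast this.symm

/-! ### Gauss-Radau quadrature for positive functionals -/

/-- The nodes `-1 = β_0 < ⋯ < β_k < 1` and the positive weights `γ_i` give a rule
`L f = ∑ i, γ_i f(β_i)` which is exact for polynomials of degree at most `2k`. -/
structure IsRadauRule (L : ℝ[X] →ₗ[ℝ] ℝ) (k : ℕ) (β γ : Fin (k + 1) → ℝ) : Prop where
  zero_node : β 0 = -1
  strictMono : StrictMono β
  lt_one : ∀ i, β i < 1
  weight_pos : ∀ i, 0 < γ i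
  exact : ∀ f : ℝ[X], f.natDegree ≤ 2 * k → L f = ∑ i, γ i * f.eval (β i)

/-- `L` is strictly positive on the polynomials which are nonnegative, but not identically zero,
on `T`. -/
def IsStrictlyPositiveOn (L : ℝ[X] →ₗ[ℝ] ℝ) (T : Finset ℝ) : Prop :=
  ∀ p : ℝ[X], (∀ t ∈ T, 0 ≤ p.eval t) → (∃ t ∈ T, 0 < p.eval t) → 0 < L p

variable {L : ℝ[X] →ₗ[ℝ] ℝ} {T : Finset ℝ} {k : ℕ}

lemma IsStrictlyPositiveOn.sq_pos (hL : IsStrictlyPositiveOn L T) (hT : k < T.card) {q : ℝ[X]}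
    (hq : q ≠ 0) (hqk : q.natDegree ≤ k) : 0 < L (q * q) := by
  refine hL _ (fun t _ => by rw [eval_mul]; exact mul_self_nonneg _) ?_
  by_contra! h
  refine hq (eq_zero_of_natDegree_lt_card_of_eval_eq_zero' q T (fun t ht => ?_) (by lia))
  have := h t ht
  rw [eval_mul] at this
  exact mul_self_eq_zero.1 (le_antisymm this (mul_self_nonneg _))

/-- At least `k` points of `T` differ from `-1`, too many to be zeros of `q`. Taking `g = 1` makes
the form with weight `1 + t` positive definite in degree below `k`; other `g` serve to locate roots.
-/
lemma IsStrictlyPositiveOn.mul_sq_pos (hL : IsStrictlyPositiveOn L T) (hT : k < T.card)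
    (hT1 : ∀ t ∈ T, -1 ≤ t) {g q : ℝ[X]} (hg : ∀ t ∈ T, -1 < t → 0 < g.eval t) (hq : q ≠ 0)
    (hqk : q.natDegree < k) : 0 < L ((1 + X) * (g * (q * q))) := by
  have hnn (t) (ht : t ∈ T) : -1 < t ∨ t = -1 := (hT1 t ht).lt_or_eq.imp_right Eq.symm
  refine hL _ (fun t ht => ?_) ?_
  · rcases hnn t ht with h | rfl
    · simp only [eval_mul, eval_add, eval_one, eval_X]
      exact mul_nonneg (by linarith) (mul_nonneg (hg t ht h).le (mul_self_nonneg _))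
    · simp
  · by_contra! h
    refine hq (eq_zero_of_natDegree_lt_card_of_eval_eq_zero' q (T.erase (-1)) (fun t ht => ?_) ?_)
    · obtain ⟨ht1, ht⟩ := Finset.mem_erase.1 ht
      have ht2 := (hnn t ht).resolve_right ht1
      have := h t ht
      simp only [eval_mul, eval_add, eval_one, eval_X] at this
      by_contra h0
      have := mul_pos (show 0 < 1 + t by linarith) (mul_pos (hg t ht ht2) (mul_self_pos.2 h0))
      linarith
    · have := Finset.pred_card_le_card_erase (s := T) (a := (-1 : ℝ))
      lia

/-- The positive definite form with weight `1 + t` represents the functional `r ↦ L ((1 + X) * (X ^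
k * r))` by some `q` of degree below `k`; then `p = X ^ k - q`. -/
lemma IsStrictlyPositiveOn.exists_orthogonal (hL : IsStrictlyPositiveOn L T) (hT : k < T.card)
    (hT1 : ∀ t ∈ T, -1 ≤ t) : ∃ p : ℝ[X], p.Monic ∧ p.natDegree = k ∧
      ∀ r : ℝ[X], r.degree < k → L ((1 + X) * (p * r)) = 0 := by
  let Φ : degreeLT ℝ k →ₗ[ℝ] Module.Dual ℝ (degreeLT ℝ k) :=
    LinearMap.mk₂ ℝ (fun q r : degreeLT ℝ k => L ((1 + X) * (q.1 * r.1)))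
      (fun a b c => by simp [add_mul, mul_add]) (fun a b c => by simp)
      (fun a b c => by simp [add_mul, mul_add]) (fun a b c => by simp)
  have hinj : Function.Injective Φ := by
    rw [injective_iff_map_eq_zero]
    rintro ⟨q, hq⟩ h
    by_contra h0
    have hq0 : q ≠ 0 := fun h => h0 (Subtype.ext h)
    have hq' : q.natDegree < k := (natDegree_lt_iff_degree_lt hq0).2 (mem_degreeLT.1 hq)
    have := hL.mul_sq_pos hT hT1 (g := 1) (fun _ _ _ => by simp) hq0 hq'
    have h1 : Φ ⟨q, hq⟩ ⟨q, hq⟩ = 0 := by rw [h]; rfl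
    rw [one_mul] at this
    exact this.ne' h1
  have hsurj := (LinearMap.injective_iff_surjective_of_finrank_eq_finrank
    (Subspace.dual_finrank_eq (K := ℝ) (V := degreeLT ℝ k)).symm).1 hinj
  obtain ⟨⟨q, hq⟩, hΦ⟩ := hsurj
    { toFun := fun r => L ((1 + X) * (X ^ k * r.1))
      map_add' := fun a b => by simp [mul_add]
      map_smul' := fun a b => by simp }
  have hqd : q.degree < (X ^ k : ℝ[X]).degree := by rw [degree_X_pow]; exact mem_degreeLT.1 hq
  refine ⟨X ^ k - q, (monic_X_pow k).sub_of_left hqd, ?_, fun r hr => ?_⟩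
  · rw [natDegree_eq_of_degree_eq (degree_sub_eq_left_of_degree_lt hqd), natDegree_X_pow]
  · have h1 : L ((1 + X) * (q * r)) = L ((1 + X) * (X ^ k * r)) :=
      LinearMap.congr_fun hΦ ⟨r, mem_degreeLT.2 hr⟩
    rw [sub_mul, mul_sub, map_sub, h1, sub_self]

lemma IsStrictlyPositiveOn.orthogonal_unique (hL : IsStrictlyPositiveOn L T) (hT : k < T.card)
    (hT1 : ∀ t ∈ T, -1 ≤ t) {p p' : ℝ[X]} (hp : p.Monic) (hpk : p.natDegree = k)
    (hpo : ∀ r : ℝ[X], r.degree < k → L ((1 + X) * (p * r)) = 0)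
    (hp' : p'.Monic) (hpk' : p'.natDegree = k)
    (hpo' : ∀ r : ℝ[X], r.degree < k → L ((1 + X) * (p' * r)) = 0) : p = p' := by
  by_contra h
  have hd : (p - p').degree < k := by
    have := degree_sub_lt_left (p := p) (q := p')
      (by rw [degree_eq_natDegree hp.ne_zero, degree_eq_natDegree hp'.ne_zero, hpk, hpk'])
      hp.ne_zero (by rw [hp.leadingCoeff, hp'.leadingCoeff])
    rwa [degree_eq_natDegree hp.ne_zero, hpk] at this
  have h1 := hL.mul_sq_pos hT hT1 (g := 1) (fun _ _ _ => by simp) (sub_ne_zero.2 h)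
    ((natDegree_lt_iff_degree_lt (sub_ne_zero.2 h)).2 hd)
  rw [one_mul, sub_mul, mul_sub, map_sub, hpo _ hd, hpo' _ hd, sub_self] at h1
  exact h1.false

/-- An orthogonal polynomial has no factorization `p = g q` with `deg q < k` and `g q q` of constant
sign. -/
lemma IsStrictlyPositiveOn.not_mul (hL : IsStrictlyPositiveOn L T) (hT : k < T.card)
    (hT1 : ∀ t ∈ T, -1 ≤ t) {p : ℝ[X]} (hp : p.Monic) (hpk : p.natDegree = k)
    (hpo : ∀ r : ℝ[X], r.degree < k → L ((1 + X) * (p * r)) = 0) {g q : ℝ[X]}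
    (hpg : p = g * q) (hg1 : 0 < g.natDegree) : ¬ ∀ t ∈ T, -1 < t → 0 < g.eval t := by
  intro hg
  have hgq : g * q ≠ 0 := hpg ▸ hp.ne_zero
  have hq : q ≠ 0 := right_ne_zero_of_mul hgq
  have hqk : q.natDegree < k := by
    rw [← hpk, hpg, natDegree_mul (left_ne_zero_of_mul hgq) hq]; lia
  have h1 := hL.mul_sq_pos hT hT1 hg hq hqk
  rw [← mul_assoc g, ← hpg, hpo q ((natDegree_lt_iff_degree_lt hq).1 hqk)] at h1
  exact h1.false

/-- A root outside `(-1,1)` or a nonreal pair of roots would give `p` a factor positive, up to sign,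
on `T` away from `-1`, against `not_mul`. -/
lemma IsStrictlyPositiveOn.exists_roots (hL : IsStrictlyPositiveOn L T) (hT : k < T.card)
    (hT1 : ∀ t ∈ T, t ∈ Set.Ico (-1 : ℝ) 1) {p : ℝ[X]} (hp : p.Monic) (hpk : p.natDegree = k)
    (hpo : ∀ r : ℝ[X], r.degree < k → L ((1 + X) * (p * r)) = 0) :
    ∃ b : Fin k → ℝ, StrictMono b ∧ (∀ i, b i ∈ Set.Ioo (-1 : ℝ) 1) ∧ p = ∏ i, (X - C (b i)) := by
  have hT' : ∀ t ∈ T, -1 ≤ t := fun t ht => (hT1 t ht).1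
  have hroot (r : ℝ) (hr : p.IsRoot r) : r ∈ Set.Ioo (-1 : ℝ) 1 := by
    obtain ⟨q, hq⟩ := dvd_iff_isRoot.2 hr
    constructor
    · by_contra! h
      refine hL.not_mul hT hT' hp hpk hpo hq (by simp) fun t ht ht1 => ?_
      simp; linarith
    · by_contra! h
      refine hL.not_mul hT hT' hp hpk hpo (g := C r - X) (q := -q) (by rw [hq]; ring) ?_
        fun t ht ht1 => ?_
      · rw [← natDegree_neg, neg_sub, natDegree_X_sub_C]; exact one_pos
      · have := (hT1 t ht).2
        simp; linarith
  have hsplit : p.Splits := by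
    refine Splits.of_splits_map (algebraMap ℝ ℂ) (IsAlgClosed.splits _) fun z hz => ?_
    have hz0 : aeval z p = 0 := by
      rw [mem_roots', IsRoot, eval_map_algebraMap] at hz; exact hz.2
    by_cases him : z.im = 0
    · exact ⟨z.re, by apply Complex.ext <;> simp [him]⟩
    exfalso
    obtain ⟨q, hq⟩ := quadratic_dvd_of_aeval_eq_zero_im_ne_zero p hz0 him
    refine hL.not_mul hT hT' hp hpk hpo hq ?_ fun t ht ht1 => ?_
    · have : X ^ 2 - C (2 * z.re) * X + C (‖z‖ ^ 2) =
          (C 1 * X ^ 2 + C (-(2 * z.re)) * X + C (‖z‖ ^ 2) : ℝ[X]) := by simp; ring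
      rw [this, natDegree_quadratic one_ne_zero]; exact two_pos
    · have h1 : ‖z‖ ^ 2 = z.re ^ 2 + z.im ^ 2 := by
        rw [Complex.sq_norm, Complex.normSq_apply]; ring
      have h2 : 0 < z.im ^ 2 := by positivity
      simp [h1]
      nlinarith [sq_nonneg (t - z.re)]
  -- For a multiple root `r` the factor `(X - r)^2` may vanish on `T`, so `not_mul` does not apply.
  -- With `p = (X - r)^2 q`, orthogonality to `q` contradicts the positivity of `L` on `(1 + X) ((X
  -- - r) q)^2`.
  have hnodup : p.roots.Nodup := by
    classical
    rw [Multiset.nodup_iff_count_le_one]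
    intro r
    rw [count_roots]
    by_contra! h
    obtain ⟨q, hq⟩ := (pow_dvd_pow (X - C r) h).trans (pow_rootMultiplicity_dvd p r)
    have hqk : ((X - C r) * q).natDegree < k ∧ (X - C r) * q ≠ 0 := by
      have h0 : (X - C r) * ((X - C r) * q) ≠ 0 := by
        have := hp.ne_zero
        rwa [hq, Nat.succ_eq_add_one, pow_succ, pow_one, mul_assoc] at this
      have h1 := hpk
      rw [hq, Nat.succ_eq_add_one, pow_succ, pow_one, mul_assoc,
        natDegree_mul (left_ne_zero_of_mul h0) (right_ne_zero_of_mul h0), natDegree_X_sub_C] at h1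
      exact ⟨by lia, right_ne_zero_of_mul h0⟩
    have hq0 : q ≠ 0 := right_ne_zero_of_mul hqk.2
    have h1 := hL.mul_sq_pos hT hT' (g := 1) (fun _ _ _ => by simp) hqk.2 hqk.1
    have h2 : q.natDegree < k := by
      refine lt_of_le_of_lt ?_ hqk.1
      rw [natDegree_mul (left_ne_zero_of_mul hqk.2) hq0]; lia
    have h3 := hpo q ((natDegree_lt_iff_degree_lt hq0).1 h2)
    have h4 : 1 * ((X - C r) * q * ((X - C r) * q)) = p * q := by rw [hq]; ring
    rw [h4, h3] at h1
    exact h1.false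
  have hcard : p.roots.toFinset.card = k := by
    rw [Multiset.toFinset_card_of_nodup hnodup, ← hsplit.natDegree_eq_card_roots, hpk]
  refine ⟨p.roots.toFinset.orderEmbOfFin hcard, OrderEmbedding.strictMono _, fun i => ?_, ?_⟩
  · refine hroot _ ?_
    have := Finset.orderEmbOfFin_mem p.roots.toFinset hcard i
    exact isRoot_of_mem_roots (Multiset.mem_toFinset.1 this)
  · conv_lhs => rw [hsplit.eq_prod_roots_of_monic hp]
    have h1 := Finset.prod_image (s := Finset.univ) (g := p.roots.toFinset.orderEmbOfFin hcard)
      (f := fun a => X - C a) ((p.roots.toFinset.orderEmbOfFin hcard).injective.injOn)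
    rw [← h1, Finset.image_orderEmbOfFin_univ, Finset.prod, Multiset.toFinset_val,
      hnodup.dedup]

/-- The nodes are `-1` and the zeros of the orthogonal polynomial `p`, with interpolatory weights.
The interpolation error is `(1 + X) p q` with `deg q < k`, so `L` kills it. The weights are values
of `L` at squares of Lagrange basis polynomials. For uniqueness, the nodes other than `-1` of any
such rule are the zeros of a monic orthogonal polynomial, which must be `p`. -/
lemma IsStrictlyPositiveOn.existsUnique_radauRule (hL : IsStrictlyPositiveOn L T)
    (hT : k < T.card) (hT1 : ∀ t ∈ T, t ∈ Set.Ico (-1 : ℝ) 1) :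
    ∃! p : (Fin (k + 1) → ℝ) × (Fin (k + 1) → ℝ), IsRadauRule L k p.1 p.2 := by
  classical
  have hT' : ∀ t ∈ T, -1 ≤ t := fun t ht => (hT1 t ht).1
  obtain ⟨p, hp, hpk, hpo⟩ := hL.exists_orthogonal hT hT'
  obtain ⟨b, hb, hb1, hpb⟩ := hL.exists_roots hT hT1 hp hpk hpo
  set β : Fin (k + 1) → ℝ := Fin.cons (-1) b with hβ
  have hβm : StrictMono β := by
    rw [hβ, Fin.strictMono_cons]
    exact ⟨fun i => (hb1 i).1, hb⟩
  have hinj : Set.InjOn β (Finset.univ : Finset (Fin (k + 1))) := hβm.injective.injOn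
  have hbasis (β : Fin (k + 1) → ℝ) (hβm : StrictMono β) (i) :
      (Lagrange.basis Finset.univ β i).natDegree = k := by
    rw [Lagrange.natDegree_basis hβm.injective.injOn (Finset.mem_univ i)]; simp
  have hbasis_eval (β : Fin (k + 1) → ℝ) (hβm : StrictMono β) (i j) :
      (Lagrange.basis Finset.univ β i).eval (β j) = if i = j then 1 else 0 := by
    split_ifs with h
    · rw [← h, Lagrange.eval_basis_self hβm.injective.injOn (Finset.mem_univ i)]
    · rw [Lagrange.eval_basis_of_ne h (Finset.mem_univ j)]
  set γ : Fin (k + 1) → ℝ := fun i => L (Lagrange.basis Finset.univ β i) with hγ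
  have hexact : ∀ f : ℝ[X], f.natDegree ≤ 2 * k → L f = ∑ i, γ i * f.eval (β i) := by
    intro f hf
    set g := Lagrange.interpolate Finset.univ β (fun i => f.eval (β i)) with hg
    have hgL : L g = ∑ i, γ i * f.eval (β i) := by
      rw [hg, Lagrange.interpolate_apply, map_sum]
      refine Finset.sum_congr rfl fun i _ => ?_
      rw [← smul_eq_C_mul, map_smul, smul_eq_mul, mul_comm]
    have hgd : g.natDegree ≤ 2 * k := by
      have := Lagrange.degree_interpolate_lt (fun i => f.eval (β i)) hinj
      rw [Finset.card_univ, Fintype.card_fin, ← mem_degreeLT, mem_degreeLT_succ] at this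
      exact this.trans (by lia)
    have hdvd : (1 + X) * p ∣ f - g := by
      have h1 : (1 + X) * p = ∏ i, (X - C (β i)) := by
        rw [Fin.prod_univ_succ, hpb]; simp [hβ, add_comm]
      rw [h1]
      refine Finset.prod_dvd_of_coprime
        ((pairwise_coprime_X_sub_C hβm.injective).set_pairwise _) fun i _ => ?_
      rw [dvd_iff_isRoot, IsRoot, eval_sub, hg,
        Lagrange.eval_interpolate_at_node _ hinj (Finset.mem_univ i), sub_self]
    obtain ⟨q, hq⟩ := hdvd
    rw [← hgL, ← sub_eq_zero, ← map_sub, hq, mul_assoc]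
    refine hpo q ?_
    rcases eq_or_ne q 0 with rfl | hq0
    · simp [bot_lt_iff_ne_bot]
    rw [← natDegree_lt_iff_degree_lt hq0]
    have h1X : (1 + X : ℝ[X]).natDegree = 1 := by
      rw [add_comm]; exact natDegree_X_add_C 1
    have h1X0 : (1 + X : ℝ[X]) ≠ 0 := by
      rintro h; rw [h] at h1X; simp at h1X
    have h2 : (f - g).natDegree ≤ 2 * k := (natDegree_sub_le_of_le hf hgd).trans (by simp)
    rw [hq, natDegree_mul (mul_ne_zero h1X0 hp.ne_zero) hq0, natDegree_mul h1X0 hp.ne_zero, h1X,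
      hpk] at h2
    lia
  refine ⟨(β, γ), ⟨rfl, hβm, fun i => ?_, fun i => ?_, hexact⟩, ?_⟩
  · refine Fin.cases ?_ (fun i => ?_) i
    · simp [hβ]
    · simpa [hβ] using (hb1 i).2
  · set l := Lagrange.basis Finset.univ β i with hl
    have h1 : L (l * l) = γ i := by
      rw [hexact (l * l) (natDegree_mul_le.trans (by rw [hbasis β hβm]; lia))]
      simp [eval_mul, hl, hbasis_eval β hβm]
    change 0 < γ i
    rw [← h1]
    exact hL.sq_pos hT (Lagrange.basis_ne_zero hinj (Finset.mem_univ i)) (hbasis β hβm i).le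
  · rintro ⟨β', γ'⟩ ⟨h0, hm, -, -, hex⟩
    simp only at h0 hm hex
    have hp' : p = ∏ i : Fin k, (X - C (β' i.succ)) := by
      have hmon : (∏ i : Fin k, (X - C (β' i.succ))).Monic :=
        monic_prod_of_monic _ _ fun i _ => monic_X_sub_C _
      have hdeg : (∏ i : Fin k, (X - C (β' i.succ))).natDegree = k := by
        rw [natDegree_prod_of_monic _ _ fun i _ => monic_X_sub_C _]; simp
      refine hL.orthogonal_unique hT hT' hp hpk hpo hmon hdeg fun r hr => ?_
      have hd : ((1 + X) * ((∏ i : Fin k, (X - C (β' i.succ))) * r)).natDegree ≤ 2 * k := by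
        rcases eq_or_ne r 0 with rfl | hr0
        · simp
        have hr' := (natDegree_lt_iff_degree_lt hr0).2 hr
        refine natDegree_mul_le.trans ?_
        have h1X : (1 + X : ℝ[X]).natDegree = 1 := by
          rw [add_comm]; exact natDegree_X_add_C 1
        have h2 := natDegree_mul_le (p := ∏ i : Fin k, (X - C (β' i.succ))) (q := r)
        lia
      rw [hex _ hd]
      refine Finset.sum_eq_zero fun i _ => ?_
      refine Fin.cases ?_ (fun i => ?_) i
      · simp [h0]
      · rw [eval_mul, eval_mul, eval_prod, Finset.prod_eq_zero (Finset.mem_univ i) (by simp)]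
        simp
    have hrange : Set.range (fun i : Fin k => β' i.succ) = Set.range b := by
      ext r
      have h1 : p.IsRoot r ↔ r ∈ Set.range b := by
        rw [hpb, IsRoot, eval_prod, Finset.prod_eq_zero_iff]
        simp [sub_eq_zero, eq_comm]
      rw [← h1, hp', IsRoot, eval_prod, Finset.prod_eq_zero_iff]
      simp [sub_eq_zero, eq_comm]
    have hb' : (fun i : Fin k => β' i.succ) = b :=
      (StrictMono.range_inj (hm.comp (Fin.strictMono_succ)) hb).1 hrange
    have hββ : β' = β := by
      funext i
      refine Fin.cases h0 (fun i => ?_) i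
      simp [hβ, ← hb']
    subst hββ
    refine Prod.ext rfl (funext fun i => ?_)
    simp only [hγ]
    rw [hex _ (by rw [hbasis β hm]; lia)]
    simp [hbasis_eval β hm]

/-! ### Rolle's theorem and Hermite interpolation -/

/-- Rolle's theorem between consecutive zeros. -/
lemma exists_deriv_eq_zero_between {f : ℝ → ℝ} {s : Set ℝ} (hs : s.OrdConnected)
    (hf : ContinuousOn f s) {m : ℕ} {z : Fin (m + 1) → ℝ} (hz : StrictMono z)
    (hzs : ∀ i, z i ∈ s) (h0 : ∀ i, f (z i) = 0) :
    ∃ w : Fin m → ℝ, ∀ i, w i ∈ Set.Ioo (z i.castSucc) (z i.succ) ∧ deriv f (w i) = 0 := by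
  have h (i : Fin m) : ∃ c ∈ Set.Ioo (z i.castSucc) (z i.succ), deriv f c = 0 :=
    exists_deriv_eq_zero (hz i.castSucc_lt_succ)
      (hf.mono (hs.out (hzs _) (hzs _))) (by rw [h0, h0])
  choose w hw using h
  exact ⟨w, hw⟩

lemma strictMono_of_interlacing {m : ℕ} {z : Fin (m + 1) → ℝ} (hz : StrictMono z)
    {w : Fin m → ℝ} (hw : ∀ i, w i ∈ Set.Ioo (z i.castSucc) (z i.succ)) : StrictMono w := by
  intro i j hij
  refine (hw i).2.trans_le (le_trans (hz.monotone ?_) (hw j).1.le)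
  rw [Fin.le_def, Fin.val_succ, Fin.val_castSucc]
  exact hij

lemma exists_iteratedDeriv_eq_zero {a b : ℝ} {n : ℕ} {f : ℝ → ℝ}
    (hf : ContDiffOn ℝ n f (Set.Ioo a b)) {Z : Finset ℝ} (hZ : Z.card = n + 1)
    (hZs : ∀ z ∈ Z, z ∈ Set.Ioo a b) (h0 : ∀ z ∈ Z, f z = 0) :
    ∃ ξ ∈ Set.Ioo a b, iteratedDeriv n f ξ = 0 := by
  induction n generalizing f Z with
  | zero =>
    obtain ⟨z, hz⟩ := Finset.card_pos.1 (by lia : 0 < Z.card)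
    exact ⟨z, hZs z hz, by simpa using h0 z hz⟩
  | succ n ih =>
    have hmem := Finset.orderEmbOfFin_mem Z hZ
    have hmono := (Z.orderEmbOfFin hZ).strictMono
    obtain ⟨w, hw⟩ := exists_deriv_eq_zero_between Set.ordConnected_Ioo hf.continuousOn hmono
      (fun i => hZs _ (hmem i)) (fun i => h0 _ (hmem i))
    have hwm := strictMono_of_interlacing hmono fun i => (hw i).1
    rw [iteratedDeriv_succ']
    refine ih (Z := Finset.univ.image w) (hf.deriv_of_isOpen isOpen_Ioo (by push_cast; rfl)) ?_ ?_ ?_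
    · rw [Finset.card_image_of_injective _ hwm.injective]; simp
    · intro z hz
      obtain ⟨i, -, rfl⟩ := Finset.mem_image.1 hz
      exact ⟨(hZs _ (hmem _)).1.trans (hw i).1.1, (hw i).1.2.trans (hZs _ (hmem _)).2⟩
    · intro z hz
      obtain ⟨i, -, rfl⟩ := Finset.mem_image.1 hz
      exact (hw i).2

/-- Iterated Rolle theorem with simple zeros in `Z` and double zeros in `D ⊆ Z`. -/
lemma exists_iteratedDeriv_eq_zero_of_double {a b : ℝ} {n : ℕ} {f : ℝ → ℝ}
    (hc : ContinuousOn f (Set.Ico a b)) (hf : ContDiffOn ℝ (n + 1 : ℕ) f (Set.Ioo a b))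
    {Z D : Finset ℝ} (hDZ : D ⊆ Z) (hZ : Z.card + D.card = n + 2)
    (hZs : ∀ z ∈ Z, z ∈ Set.Ico a b) (hDs : ∀ z ∈ D, z ∈ Set.Ioo a b) (h0 : ∀ z ∈ Z, f z = 0)
    (hD0 : ∀ z ∈ D, deriv f z = 0) :
    ∃ ξ ∈ Set.Ioo a b, iteratedDeriv (n + 1) f ξ = 0 := by
  obtain ⟨m, hm⟩ : ∃ m, Z.card = m + 1 := by
    have := Finset.card_le_card hDZ
    exact ⟨Z.card - 1, by lia⟩
  have hmem := Finset.orderEmbOfFin_mem Z hm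
  have hmono := (Z.orderEmbOfFin hm).strictMono
  obtain ⟨w, hw⟩ := exists_deriv_eq_zero_between Set.ordConnected_Ico hc hmono
    (fun i => hZs _ (hmem i)) (fun i => h0 _ (hmem i))
  have hwm := strictMono_of_interlacing hmono fun i => (hw i).1
  -- Rolle points lie strictly between consecutive points of `Z`, so they are new, and `f'` has
  -- `(|Z| - 1) + |D| = n + 1` distinct zeros.
  have hdisj : Disjoint (Finset.univ.image w) D := by
    rw [Finset.disjoint_left]
    intro z hz hzD
    obtain ⟨i, -, rfl⟩ := Finset.mem_image.1 hz
    have h1 : w i ∈ Set.range (Z.orderEmbOfFin hm) := by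
      rw [Finset.range_orderEmbOfFin]; exact hDZ hzD
    obtain ⟨j, hj⟩ := h1
    have h2 := (hw i).1
    rw [← hj, Set.mem_Ioo, hmono.lt_iff_lt, hmono.lt_iff_lt, Fin.lt_def, Fin.lt_def,
      Fin.val_castSucc, Fin.val_succ] at h2
    lia
  rw [iteratedDeriv_succ']
  refine exists_iteratedDeriv_eq_zero (Z := Finset.univ.image w ∪ D)
    (hf.deriv_of_isOpen isOpen_Ioo (by push_cast; rfl)) ?_ ?_ ?_
  · rw [Finset.card_union_of_disjoint hdisj, Finset.card_image_of_injective _ hwm.injective,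
      Finset.card_univ, Fintype.card_fin]
    lia
  · intro z hz
    rcases Finset.mem_union.1 hz with hz | hz
    · obtain ⟨i, -, rfl⟩ := Finset.mem_image.1 hz
      exact ⟨(hZs _ (hmem _)).1.trans_lt (hw i).1.1, (hw i).1.2.trans (hZs _ (hmem _)).2⟩
    · exact hDs z hz
  · intro z hz
    rcases Finset.mem_union.1 hz with hz | hz
    · obtain ⟨i, -, rfl⟩ := Finset.mem_image.1 hz
      exact (hw i).2
    · exact hD0 z hz

lemma iteratedDeriv_eval (p : ℝ[X]) (n : ℕ) (x : ℝ) :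
    iteratedDeriv n (fun t => p.eval t) x = (derivative^[n] p).eval x := by
  induction n generalizing p with
  | zero => simp
  | succ n ih =>
    have : deriv (fun t => p.eval t) = fun t => (derivative p).eval t := by
      ext t; exact p.deriv
    rw [iteratedDeriv_succ', this, ih, Function.iterate_succ_apply]

lemma iterate_derivative_eval_of_natDegree_le {p : ℝ[X]} {n : ℕ} (hp : p.natDegree ≤ n) (x : ℝ) :
    (derivative^[n] p).eval x = n.factorial * p.coeff n := by
  have h := natDegree_iterate_derivative p n
  rw [eq_C_of_natDegree_le_zero (h.trans (by lia)), eval_C, coeff_iterate_derivative, zero_add,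
    Nat.descFactorial_self, nsmul_eq_mul]

/-- The polynomial `(t - l) ∏ i, (t - b i) ^ 2`. -/
noncomputable def hermiteNodal {k : ℕ} (l : ℝ) (b : Fin k → ℝ) : ℝ[X] :=
  (X - C l) * ∏ i, (X - C (b i)) ^ 2

lemma hermiteNodal_monic {k : ℕ} (l : ℝ) (b : Fin k → ℝ) : (hermiteNodal l b).Monic :=
  (monic_X_sub_C l).mul (monic_prod_of_monic _ _ fun _ _ => (monic_X_sub_C _).pow 2)

lemma natDegree_hermiteNodal {k : ℕ} (l : ℝ) (b : Fin k → ℝ) :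
    (hermiteNodal l b).natDegree = 2 * k + 1 := by
  rw [hermiteNodal, (monic_X_sub_C l).natDegree_mul
    (monic_prod_of_monic _ _ fun i _ => (monic_X_sub_C _).pow 2), natDegree_X_sub_C,
    natDegree_prod_of_monic _ _ fun i _ => (monic_X_sub_C _).pow 2]
  simp [(monic_X_sub_C _).natDegree_pow]
  ring

lemma hermiteNodal_eval {k : ℕ} (l : ℝ) (b : Fin k → ℝ) (t : ℝ) :
    (hermiteNodal l b).eval t = (t - l) * ∏ i, (t - b i) ^ 2 := by
  simp [hermiteNodal, eval_prod]

lemma sq_dvd_hermiteNodal {k : ℕ} (l : ℝ) (b : Fin k → ℝ) (i : Fin k) :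
    (X - C (b i)) ^ 2 ∣ hermiteNodal l b :=
  (Finset.dvd_prod_of_mem (fun i => (X - C (b i)) ^ 2) (Finset.mem_univ i)).mul_left _

lemma sq_dvd_iff {p : ℝ[X]} {a : ℝ} :
    (X - C a) ^ 2 ∣ p ↔ p.eval a = 0 ∧ (derivative p).eval a = 0 := by
  rcases eq_or_ne p 0 with rfl | hp
  · simp
  · rw [← le_rootMultiplicity_iff hp]
    exact one_lt_rootMultiplicity_iff_isRoot hp

lemma hermiteNodal_dvd {k : ℕ} {l : ℝ} {b : Fin k → ℝ} (hb : Function.Injective b)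
    (hl : ∀ i, b i ≠ l) {p : ℝ[X]} (hpl : p.eval l = 0) (hp : ∀ i, p.eval (b i) = 0)
    (hp' : ∀ i, (derivative p).eval (b i) = 0) : hermiteNodal l b ∣ p := by
  refine IsCoprime.mul_dvd ?_ (dvd_iff_isRoot.2 hpl) ?_
  · refine IsCoprime.prod_right fun i _ => IsCoprime.pow_right ?_
    exact isCoprime_X_sub_C_of_isUnit_sub (sub_ne_zero.2 (hl i).symm).isUnit
  · refine Finset.prod_dvd_of_coprime (fun _ _ _ _ hij => ?_)
      fun i _ => sq_dvd_iff.2 ⟨hp i, hp' i⟩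
    exact (isCoprime_X_sub_C_of_isUnit_sub (sub_ne_zero.2 (hb.ne hij)).isUnit).pow

/-- There are `2k + 1` linear conditions on a space of dimension `2k + 1`, and a polynomial in the
kernel is divisible by `hermiteNodal l b`, of degree `2k + 1`. -/
lemma existsUnique_hermite {k : ℕ} {l : ℝ} {b : Fin k → ℝ} (hb : Function.Injective b)
    (hl : ∀ i, b i ≠ l) (u : ℝ) (v v' : Fin k → ℝ) :
    ∃! G : ℝ[X], G.natDegree ≤ 2 * k ∧ G.eval l = u ∧ (∀ i, G.eval (b i) = v i) ∧
      ∀ i, (derivative G).eval (b i) = v' i := by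
  let φ : degreeLT ℝ (2 * k + 1) →ₗ[ℝ] ℝ × (Fin k → ℝ) × (Fin k → ℝ) :=
    { toFun := fun p => (p.1.eval l, fun i => p.1.eval (b i), fun i => (derivative p.1).eval (b i))
      map_add' := fun p q => by
        ext <;> simp
      map_smul' := fun r p => by
        ext <;> simp }
  have hinj : Function.Injective φ := by
    rw [injective_iff_map_eq_zero]
    rintro ⟨p, hp⟩ h
    have h1 : p.eval l = 0 := congrArg Prod.fst h
    have h2 : ∀ i, p.eval (b i) = 0 := congrFun (congrArg (fun x => x.2.1) h)
    have h3 : ∀ i, (derivative p).eval (b i) = 0 := congrFun (congrArg (fun x => x.2.2) h)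
    have hd := hermiteNodal_dvd hb hl h1 h2 h3
    ext1
    refine eq_zero_of_dvd_of_natDegree_lt hd ?_
    rw [natDegree_hermiteNodal]
    exact Nat.lt_succ_of_le (mem_degreeLT_succ.1 hp)
  have hsurj := (LinearMap.injective_iff_surjective_of_finrank_eq_finrank (by
    rw [(degreeLTEquiv ℝ (2 * k + 1)).finrank_eq]
    simp
    ring)).1 hinj
  obtain ⟨⟨G, hG⟩, h⟩ := hsurj (u, v, v')
  refine ⟨G, ⟨mem_degreeLT_succ.1 hG, congrArg Prod.fst h, congrFun (congrArg (fun x => x.2.1) h),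
    congrFun (congrArg (fun x => x.2.2) h)⟩, ?_⟩
  rintro G' ⟨h1, h2, h3, h4⟩
  have : (⟨G', mem_degreeLT_succ.2 h1⟩ : degreeLT ℝ (2 * k + 1)) = ⟨G, hG⟩ := by
    apply hinj
    rw [h]
    exact Prod.ext h2 (Prod.ext (funext h3) (funext h4))
  exact congrArg Subtype.val this

/-- The error formula of Hermite interpolation with one simple and `k` double nodes. -/
lemma exists_hermite_error {a b l : ℝ} {k : ℕ} {h : ℝ → ℝ} (hc : ContinuousOn h (Set.Ico a b))
    (hh : ContDiffOn ℝ (2 * k + 1 : ℕ) h (Set.Ioo a b)) {x : Fin k → ℝ}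
    (hx : Function.Injective x) (hxs : ∀ i, x i ∈ Set.Ioo a b) (hl : ∀ i, x i ≠ l)
    (hls : l ∈ Set.Ico a b) {G : ℝ[X]} (hG : G.natDegree ≤ 2 * k) (hGl : G.eval l = h l)
    (hGx : ∀ i, G.eval (x i) = h (x i)) (hGx' : ∀ i, (derivative G).eval (x i) = deriv h (x i))
    {t : ℝ} (ht : t ∈ Set.Ico a b) (htl : t ≠ l) (htx : ∀ i, x i ≠ t) :
    ∃ ξ ∈ Set.Ioo a b, h t - G.eval t =
      iteratedDeriv (2 * k + 1) h ξ / (2 * k + 1).factorial * (hermiteNodal l x).eval t := by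
  set W := hermiteNodal l x with hW
  have hWt : W.eval t ≠ 0 := by
    rw [hW, hermiteNodal_eval]
    exact mul_ne_zero (sub_ne_zero.2 htl) (Finset.prod_ne_zero_iff.2 fun i _ =>
      pow_ne_zero _ (sub_ne_zero.2 (htx i).symm))
  -- This `c` makes `P` agree with `h` at `t` too. Then `h - P` has `2k + 2` zeros with
  -- multiplicity, and the derivative of `P` of order `2k + 1` is the constant `(2k + 1)! c`.
  set c := (h t - G.eval t) / W.eval t with hcdef
  set P := G + C c * W with hP
  set F : ℝ → ℝ := h - fun s => P.eval s with hF
  have hWx (i) : W.eval (x i) = 0 ∧ (derivative W).eval (x i) = 0 :=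
    sq_dvd_iff.1 (sq_dvd_hermiteNodal l x i)
  have hPx (i) : P.eval (x i) = h (x i) := by simp [hP, hGx, hWx]
  have hPx' (i) : (derivative P).eval (x i) = deriv h (x i) := by simp [hP, hGx', hWx]
  have hcd (s) (hs : s ∈ Set.Ioo a b) : ContDiffAt ℝ (2 * k + 1 : ℕ) h s :=
    hh.contDiffAt (isOpen_Ioo.mem_nhds hs)
  have hPc : ContDiff ℝ (2 * k + 1 : ℕ) (fun s => P.eval s) := by
    simpa [coe_aeval_eq_eval] using P.contDiff_aeval (𝕜 := ℝ) (2 * k + 1 : ℕ)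
  obtain ⟨ξ, hξ, h0⟩ := exists_iteratedDeriv_eq_zero_of_double (f := F) (n := 2 * k)
    (Z := insert t (insert l (Finset.univ.image x))) (D := Finset.univ.image x)
    (hc.sub P.continuous.continuousOn) (hh.sub hPc.contDiffOn)
    ((Finset.subset_insert _ _).trans (Finset.subset_insert _ _))
    (by
      rw [Finset.card_insert_of_notMem, Finset.card_insert_of_notMem,
        Finset.card_image_of_injective _ hx, Finset.card_univ, Fintype.card_fin]
      · ring
      · simpa using hl
      · simpa [htl] using htx)
    (by
      intro z hz
      simp only [Finset.mem_insert, Finset.mem_image, Finset.mem_univ, true_and] at hz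
      rcases hz with rfl | rfl | ⟨i, rfl⟩
      · exact ht
      · exact hls
      · exact Set.Ioo_subset_Ico_self (hxs i))
    (by
      intro z hz
      simp only [Finset.mem_image, Finset.mem_univ, true_and] at hz
      obtain ⟨i, rfl⟩ := hz
      exact hxs i)
    (by
      intro z hz
      simp only [Finset.mem_insert, Finset.mem_image, Finset.mem_univ, true_and] at hz
      rcases hz with rfl | rfl | ⟨i, rfl⟩
      · simp [hF, hP, hcdef, div_mul_cancel₀ _ hWt]
      · simp [hF, hP, hGl, hW, hermiteNodal_eval]
      · simp [hF, hPx])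
    (by
      intro z hz
      simp only [Finset.mem_image, Finset.mem_univ, true_and] at hz
      obtain ⟨i, rfl⟩ := hz
      rw [hF, deriv_sub ((hcd _ (hxs i)).differentiableAt (by simp)) P.differentiableAt, P.deriv,
        hPx', sub_self])
  refine ⟨ξ, hξ, ?_⟩
  have hWd := natDegree_hermiteNodal l x
  have hPd : P.natDegree ≤ 2 * k + 1 :=
    natDegree_add_le_of_degree_le (by lia) ((natDegree_C_mul_le _ _).trans hWd.le)
  have hPco : P.coeff (2 * k + 1) = c := by
    have h1 : W.coeff (2 * k + 1) = 1 := by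
      rw [hW, ← hWd]; exact (hermiteNodal_monic l x).coeff_natDegree
    rw [hP, coeff_add, coeff_C_mul, coeff_eq_zero_of_natDegree_lt (by lia), h1]; ring
  rw [hF, iteratedDeriv_sub (hcd ξ hξ) hPc.contDiffAt, iteratedDeriv_eval,
    iterate_derivative_eval_of_natDegree_le hPd, hPco, sub_eq_zero] at h0
  have hfac : ((2 * k + 1).factorial : ℝ) ≠ 0 := by positivity
  rw [h0, mul_div_cancel_left₀ _ hfac, hcdef, div_mul_cancel₀ _ hWt]

/-! ### The quadrature of a design, the range of `ℓ`, and the linear programming bound -/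

/-- The functional `f ↦ |D|⁻¹ ∑_{y ∈ D, y ≠ x} f(⟨x,y⟩)`. -/
noncomputable def designFunctional {n : ℕ} (D : Finset (Cube n)) (x : Cube n) : ℝ[X] →ₗ[ℝ] ℝ where
  toFun f := (∑ y ∈ D.erase x, f.eval (ip x y)) / D.card
  map_add' f g := by simp [Finset.sum_add_distrib, add_div]
  map_smul' r f := by simp [← Finset.mul_sum, mul_div_assoc]

lemma designFunctional_apply {n : ℕ} (D : Finset (Cube n)) (x : Cube n) (f : ℝ[X]) :
    designFunctional D x f = (∑ y ∈ D.erase x, f.eval (ip x y)) / D.card := rfl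

lemma designFunctional_isStrictlyPositiveOn {n : ℕ} {D : Finset (Cube n)} {x : Cube n}
    (hx : x ∈ D) : IsStrictlyPositiveOn (designFunctional D x) ((D.erase x).image (ip x)) := by
  intro p hp ⟨t, ht, hpt⟩
  obtain ⟨y, hy, rfl⟩ := Finset.mem_image.1 ht
  rw [designFunctional_apply]
  refine div_pos (Finset.sum_pos' (fun z hz => hp _ (Finset.mem_image_of_mem _ hz)) ⟨y, hy, hpt⟩) ?_
  exact_mod_cast Finset.card_pos.2 ⟨x, hx⟩

/-- The full sum over `D` retains only `c 0`, and the omitted term `y = x` is `f(1)`. The right side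
depends on `D` only through its cardinality. -/
lemma IsDesign.designFunctional_eq {n τ : ℕ} (hn : 0 < n) (hτ : τ ≤ n) {D : Finset (Cube n)}
    (hD : IsDesign τ D) {x : Cube n} (hx : x ∈ D) {f : ℝ[X]} {c : Fin (τ + 1) → ℝ}
    (hf : IsKrawExpansion n f c) :
    designFunctional D x f = c 0 - f.eval 1 / D.card := by
  have hM : (D.card : ℝ) ≠ 0 := by exact_mod_cast (Finset.card_pos.2 ⟨x, hx⟩).ne'
  have h := hD.sum_eval_ip hn hτ x hf
  rw [← Finset.add_sum_erase _ _ hx, ip_self] at h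
  rw [designFunctional_apply, eq_sub_iff_add_eq, ← add_div, add_comm, h, mul_div_cancel_right₀ _ hM]

lemma IsDesign.strength_le {n τ : ℕ} {D : Finset (Cube n)} (hD : IsDesign τ D) : τ ≤ n := by
  obtain ⟨lam, hlam, hcard, -⟩ := hD
  have h1 : D.card ≤ 2 ^ n := by
    refine (Finset.card_le_univ D).trans ?_
    simp
  have h2 : 2 ^ τ ≤ D.card := hcard ▸ Nat.le_mul_of_pos_left _ hlam
  exact (Nat.pow_le_pow_iff_right one_lt_two).1 (h2.trans h1)

lemma IsDesign.isQuadrature_iff {n k : ℕ} (hn : 0 < n) {D : Finset (Cube n)}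
    (hD : IsDesign (2 * k) D) {x : Cube n} (hx : x ∈ D) {β γ : Fin (k + 1) → ℝ} :
    IsQuadrature n D.card k β γ ↔ IsRadauRule (designFunctional D x) k β γ := by
  constructor
  · rintro ⟨h1, h2, h3, h4, h5⟩
    refine ⟨h1, h2, h3, h4, fun f hf => ?_⟩
    obtain ⟨c, hc⟩ := exists_isKrawExpansion hn _ hD.strength_le f hf
    rw [hD.designFunctional_eq hn hD.strength_le hx hc, h5 f c hf hc, add_sub_cancel_left]
  · rintro ⟨h1, h2, h3, h4, h5⟩
    refine ⟨h1, h2, h3, h4, fun f c hf hc => ?_⟩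
    rw [← h5 f hf, hD.designFunctional_eq hn hD.strength_le hx hc, add_sub_cancel]

lemma IsDesign.existsUnique_isQuadrature {n k : ℕ} (hn : 0 < n) {D : Finset (Cube n)}
    (hD : IsDesign (2 * k) D) (hM : rao n (2 * k) < D.card) :
    ∃! p : (Fin (k + 1) → ℝ) × (Fin (k + 1) → ℝ), IsQuadrature n D.card k p.1 p.2 := by
  obtain ⟨x, hx⟩ := Finset.card_pos.1 (by lia : 0 < D.card)
  simp only [hD.isQuadrature_iff hn hx]
  have hT : ∀ t ∈ (D.erase x).image (ip x), t ∈ Set.Ico (-1 : ℝ) 1 := by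
    intro t ht
    obtain ⟨y, hy, rfl⟩ := Finset.mem_image.1 ht
    exact ip_mem_Ico (Finset.ne_of_mem_erase hy).symm
  refine (designFunctional_isStrictlyPositiveOn hx).existsUnique_radauRule ?_ hT
  -- With at most `k` inner products from `x`, the product of the `X - t` over them would have
  -- degree at most `k` and force equality in the Rao bound.
  by_contra! h
  refine hM.ne' (hD.card_eq_rao_of_eval_eq_zero hn hD.strength_le hx
    (q := ∏ t ∈ (D.erase x).image (ip x), (X - C t)) ?_ ?_ fun y hy hyx => ?_)
  · rw [natDegree_prod_of_monic _ _ fun t _ => monic_X_sub_C t]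
    simpa using h
  · rw [eval_prod, Finset.prod_ne_zero_iff]
    intro t ht
    rw [eval_sub, eval_X, eval_C, sub_ne_zero]
    exact (hT t ht).2.ne'
  · rw [eval_prod]
    exact Finset.prod_eq_zero
      (Finset.mem_image_of_mem _ (Finset.mem_erase.2 ⟨hyx, hy⟩)) (by simp)

/-- The test polynomial `(t - β_1) ∏_{i ≥ 2} (t - β_i)^2` vanishes at every node except `-1`, where
it is negative, so the functional is negative on it. But it is nonnegative for `t ≥ β_1`. -/
lemma IsRadauRule.exists_ip_lt {n k : ℕ} {D : Finset (Cube n)} {x : Cube n}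
    {β γ : Fin (k + 1) → ℝ} (hQ : IsRadauRule (designFunctional D x) k β γ) (hk : 0 < k) :
    ∃ y ∈ D, x ≠ y ∧ ∀ i : Fin k, ip x y < β i.succ := by
  set j : Fin k := ⟨0, hk⟩ with hj
  set f : ℝ[X] := (X - C (β j.succ)) * ∏ i ∈ Finset.univ.erase j, (X - C (β i.succ)) ^ 2 with hf
  have hfe (t : ℝ) : f.eval t = (t - β j.succ) * ∏ i ∈ Finset.univ.erase j, (t - β i.succ) ^ 2 := by
    simp [hf, eval_prod]
  have hdeg : f.natDegree ≤ 2 * k := by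
    rw [hf, (monic_X_sub_C _).natDegree_mul
      (monic_prod_of_monic _ _ fun i _ => (monic_X_sub_C _).pow 2), natDegree_X_sub_C,
      natDegree_prod_of_monic _ _ fun i _ => (monic_X_sub_C _).pow 2]
    simp [(monic_X_sub_C _).natDegree_pow]
    lia
  have hlt (i : Fin k) : -1 < β i.succ := by
    rw [← hQ.zero_node]; exact hQ.strictMono (Fin.succ_pos i)
  have hneg : designFunctional D x f < 0 := by
    rw [hQ.exact f hdeg, Fin.sum_univ_succ, Finset.sum_eq_zero, add_zero, hQ.zero_node, hfe]
    · refine mul_neg_of_pos_of_neg (hQ.weight_pos 0) (mul_neg_of_neg_of_pos ?_ ?_)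
      · linarith [hlt j]
      · refine Finset.prod_pos fun i _ => ?_
        have : (-1 : ℝ) - β i.succ ≠ 0 := by linarith [hlt i]
        positivity
    · intro i _
      rw [hfe]
      by_cases hij : i = j
      · simp [hij]
      · rw [Finset.prod_eq_zero (Finset.mem_erase.2 ⟨hij, Finset.mem_univ i⟩) (by simp)]
        simp
  by_contra! h
  refine hneg.not_ge ?_
  rw [designFunctional_apply]
  refine div_nonneg (Finset.sum_nonneg fun y hy => ?_) (Nat.cast_nonneg _)
  obtain ⟨hyx, hy⟩ := Finset.mem_erase.1 hy
  obtain ⟨i, hi⟩ := h y hy hyx.symm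
  rw [hfe]
  refine mul_nonneg ?_ (Finset.prod_nonneg fun i _ => sq_nonneg _)
  have : β j.succ ≤ β i.succ :=
    hQ.strictMono.monotone (Fin.succ_le_succ_iff.2 (Fin.le_def.2 (Nat.zero_le _)))
  linarith

lemma finite_setOf_ip {n : ℕ} (D : Finset (Cube n)) :
    {t : ℝ | ∃ x ∈ D, ∃ y ∈ D, x ≠ y ∧ t = ip x y}.Finite := by
  refine ((D ×ˢ D).image fun p => ip p.1 p.2).finite_toSet.subset ?_
  rintro t ⟨x, hx, y, hy, -, rfl⟩
  exact Finset.mem_coe.2 (Finset.mem_image.2 ⟨(x, y), Finset.mem_product.2 ⟨hx, hy⟩, rfl⟩)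

lemma designMinIp_le {n M τ : ℕ} {D : Finset (Cube n)} (hD : D ∈ designs n M τ) {x y : Cube n}
    (hx : x ∈ D) (hy : y ∈ D) (hxy : x ≠ y) : designMinIp n M τ ≤ ip x y :=
  (csInf_le (Set.toFinite _).bddBelow (Set.mem_image_of_mem _ hD)).trans
    (csInf_le (finite_setOf_ip D).bddBelow ⟨x, hx, y, hy, hxy, rfl⟩)

/-- Both infima run over finite sets, nonempty because `M > 1`, so they are attained. -/
lemma exists_designMinIp_eq {n M τ : ℕ} (h : (designs n M τ).Nonempty) (hM : 1 < M) :
    ∃ D ∈ designs n M τ, ∃ x ∈ D, ∃ y ∈ D, x ≠ y ∧ designMinIp n M τ = ip x y := by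
  obtain ⟨D, hD, hDeq⟩ := (h.image minIp).csInf_mem (Set.toFinite _)
  obtain ⟨x, hx, y, hy, hxy⟩ := Finset.one_lt_card.1 (hD.2.symm ▸ hM : 1 < D.card)
  obtain ⟨x', hx', y', hy', hxy', h'⟩ :=
    Set.Nonempty.csInf_mem (s := {t : ℝ | ∃ x ∈ D, ∃ y ∈ D, x ≠ y ∧ t = ip x y})
      ⟨ip x y, x, hx, y, hy, hxy, rfl⟩ (finite_setOf_ip D)
  exact ⟨D, hD, x', hx', y', hy', hxy', hDeq.symm.trans h'⟩

lemma IsDesign.sum_offDiag {n τ : ℕ} (hn : 0 < n) {D : Finset (Cube n)} (hD : IsDesign τ D)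
    {f : ℝ[X]} {c : Fin (τ + 1) → ℝ} (hf : IsKrawExpansion n f c) :
    ∑ p ∈ D.offDiag, f.eval (ip p.1 p.2) = D.card * (c 0 * D.card - f.eval 1) := by
  have h1 : ∑ p ∈ D ×ˢ D, f.eval (ip p.1 p.2) = D.card * (c 0 * D.card) := by
    rw [Finset.sum_product, Finset.sum_congr rfl fun x _ => hD.sum_eval_ip hn hD.strength_le x hf,
      Finset.sum_const, nsmul_eq_mul]
  rw [← Finset.diag_union_offDiag, Finset.sum_union (Finset.disjoint_diag_offDiag D),
    Finset.sum_diag] at h1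
  simp only [ip_self, Finset.sum_const, nsmul_eq_mul] at h1
  linear_combination h1

/-- On a design the energy of the polynomial `f` itself is exactly `c 0 * D.card - f.eval 1`. -/
lemma le_energy_of_le {n τ : ℕ} (hn : 0 < n) {D : Finset (Cube n)} (hD : IsDesign τ D)
    {f : ℝ[X]} {c : Fin (τ + 1) → ℝ} (hf : IsKrawExpansion n f c) {h : ℝ → ℝ}
    (hfh : ∀ x ∈ D, ∀ y ∈ D, x ≠ y → f.eval (ip x y) ≤ h (ip x y)) :
    c 0 * D.card - f.eval 1 ≤ energy h D := by
  have hM : (0 : ℝ) < D.card := by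
    obtain ⟨lam, hlam, hcard, -⟩ := hD
    rw [hcard]; positivity
  rw [energy, one_div, ← div_eq_inv_mul, le_div_iff₀ hM, mul_comm, ← hD.sum_offDiag hn hf]
  refine Finset.sum_le_sum fun p hp => ?_
  obtain ⟨h1, h2, h3⟩ := Finset.mem_offDiag.1 hp
  exact hfh _ h1 _ h2 h3

lemma natCast_le_top (m : ℕ) : (m : WithTop ℕ∞) ≤ ((⊤ : ℕ∞) : WithTop ℕ∞) := by
  exact_mod_cast le_top

lemma iteratedDerivWithin_Ico_eq {h : ℝ → ℝ} {a b : ℝ}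
    (hh : ContDiffOn ℝ (⊤ : ℕ∞) h (Set.Ico a b)) (m : ℕ) {ξ : ℝ} (hξ : ξ ∈ Set.Ioo a b) :
    iteratedDerivWithin m h (Set.Ico a b) ξ = iteratedDeriv m h ξ :=
  iteratedDerivWithin_eq_iteratedDeriv (uniqueDiffOn_Ico a b)
    ((hh.of_le (natCast_le_top m)).contDiffAt (Ico_mem_nhds hξ.1 hξ.2))
    (Set.Ioo_subset_Ico_self hξ)

end HammingEnergy

/-! ### The main theorem -/

open HammingEnergy
theorem mainTheorem5 (n k M : ℕ) (hn : 0 < n) (hk : 0 < k)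
    (hM : rao n (2 * k) < M) (hM' : M < rao n (2 * k + 1))
    (hdesign : (designs n M (2 * k)).Nonempty)
    (h : ℝ → ℝ) (hh : AbsolutelyMonotoneOn h (Set.Ico (-1) 1)) :
    (∃! p : (Fin (k + 1) → ℝ) × (Fin (k + 1) → ℝ), IsQuadrature n M k p.1 p.2) ∧
    ∀ β γ : Fin (k + 1) → ℝ, IsQuadrature n M k β γ →
      (∃! G : ℝ[X], IsHermite h (designMinIp n M (2 * k)) β G) ∧
      ∀ G : ℝ[X], IsHermite h (designMinIp n M (2 * k)) β G →
        (∃! c : Fin (2 * k + 1) → ℝ, IsKrawExpansion n G c) ∧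
        ∀ c : Fin (2 * k + 1) → ℝ, IsKrawExpansion n G c →
          ((c 0 * M - G.eval 1 : ℝ) : EReal) ≤ minDesignEnergy n M (2 * k) h ∧
          M * ∑ i, γ i * h (β i) ≤ c 0 * M - G.eval 1 ∧
          (StrictlyAbsolutelyMonotoneOn h (Set.Ico (-1) 1) →
            M * ∑ i, γ i * h (β i) < c 0 * M - G.eval 1) := by
  obtain ⟨D, hD, rfl⟩ := hdesign
  have hkn := hD.strength_le
  refine ⟨hD.existsUnique_isQuadrature hn hM, fun β γ hQ => ?_⟩
  obtain ⟨x, hx⟩ := Finset.card_pos.1 (by lia : 0 < D.card)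
  have hR := (hD.isQuadrature_iff hn hx).1 hQ
  have hM1 : 1 < D.card := by
    have : 0 < rao n (2 * k) := by
      rw [rao_two_mul]
      exact Finset.card_pos.2 ⟨∅, by simp⟩
    lia
  set l := designMinIp n D.card (2 * k) with hl
  have hDmem : D ∈ designs n D.card (2 * k) := ⟨hD, rfl⟩
  have hlβ (i : Fin k) : l < β i.succ := by
    obtain ⟨y, hy, hxy, hlt⟩ := hR.exists_ip_lt hk
    exact (designMinIp_le hDmem hx hy hxy).trans_lt (hlt i)
  -- A design attaining `ℓ = -1` would contain an antipodal pair, which `M < R(n,2k+1)` excludes.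
  have hl1 : -1 < l := by
    obtain ⟨D', hD', u, hu, v, hv, huv, he⟩ := exists_designMinIp_eq ⟨D, hDmem⟩ hM1
    rw [hl, he]
    refine lt_of_le_of_ne (ip_mem_Ico huv).1 fun h1 => ?_
    have := hD'.1.rao_le_card_of_antipodal hn hkn hu hv h1.symm
    rw [hD'.2] at this
    lia
  have hβinj : Function.Injective fun i : Fin k => β i.succ :=
    hQ.strictMono.injective.comp (Fin.succ_injective k)
  have hβne (i : Fin k) : β i.succ ≠ l := (hlβ i).ne'
  have hβmem (i : Fin k) : β i.succ ∈ Set.Ioo (-1 : ℝ) 1 :=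
    ⟨hl1.trans (hlβ i), hQ.lt_one _⟩
  have hlmem : l ∈ Set.Ico (-1 : ℝ) 1 :=
    ⟨hl1.le, (hlβ ⟨0, hk⟩).trans (hQ.lt_one _)⟩
  constructor
  · obtain ⟨G, ⟨h1, h2, h3, h4⟩, hu⟩ := existsUnique_hermite hβinj hβne (h l)
      (fun i => h (β i.succ)) (fun i => deriv h (β i.succ))
    exact ⟨G, ⟨h1, h2, h3, h4⟩, fun G' ⟨h1, h2, h3, h4⟩ => hu G' ⟨h1, h2, h3, h4⟩⟩
  intro G hG
  refine ⟨existsUnique_isKrawExpansion hn hkn hG.natDegree_le, fun c hc => ?_⟩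
  have hsm := hh.contDiffOn
  have herr {t : ℝ} (ht : t ∈ Set.Ico (-1 : ℝ) 1) (htl : t ≠ l) (htβ : ∀ i : Fin k, β i.succ ≠ t) :=
    exists_hermite_error hsm.continuousOn
      ((hsm.mono Set.Ioo_subset_Ico_self).of_le (natCast_le_top _))
      hβinj hβmem hβne hlmem hG.natDegree_le hG.eval_left hG.eval_node hG.deriv_node ht htl htβ
  have hfac : (0 : ℝ) < (2 * k + 1).factorial := by positivity
  have hnonneg {ξ : ℝ} (hξ : ξ ∈ Set.Ioo (-1 : ℝ) 1) : 0 ≤ iteratedDeriv (2 * k + 1) h ξ := by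
    rw [← iteratedDerivWithin_Ico_eq hsm _ hξ]
    exact hh.iteratedDerivWithin_nonneg (uniqueDiffOn_Ico _ _) _ (Set.Ioo_subset_Ico_self hξ)
  have hGle {t : ℝ} (ht : t ∈ Set.Ico (-1 : ℝ) 1) (hlt : l ≤ t) : G.eval t ≤ h t := by
    rcases eq_or_ne t l with rfl | htl
    · exact hG.eval_left.le
    by_cases htβ : ∀ i : Fin k, β i.succ ≠ t
    · obtain ⟨ξ, hξ, he⟩ := herr ht htl htβ
      rw [← sub_nonneg, he, hermiteNodal_eval]
      exact mul_nonneg (div_nonneg (hnonneg hξ) hfac.le)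
        (mul_nonneg (sub_nonneg.2 hlt) (Finset.prod_nonneg fun i _ => sq_nonneg _))
    · push Not at htβ
      obtain ⟨i, rfl⟩ := htβ
      exact (hG.eval_node i).le
  -- At `-1`, left of `ℓ`, the nodal polynomial is negative and the error changes sign.
  obtain ⟨ξ, hξ, he⟩ := herr (t := -1) (by norm_num) hl1.ne fun i => (hβmem i).1.ne'
  have hW : (hermiteNodal l fun i : Fin k => β i.succ).eval (-1) < 0 := by
    rw [hermiteNodal_eval]
    refine mul_neg_of_neg_of_pos (by linarith) (Finset.prod_pos fun i _ => ?_)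
    have : (-1 : ℝ) - β i.succ ≠ 0 := by linarith [(hβmem i).1]
    positivity
  have hMpos : (0 : ℝ) < D.card := by exact_mod_cast (by lia : 0 < D.card)
  -- In the quadrature for `G`, the values at `β_1, …, β_k` are those of `h`; only the node `-1`
  -- leaves a discrepancy.
  have hdiff : c 0 * D.card - G.eval 1 = D.card * ∑ i, γ i * h (β i) -
      D.card * γ 0 * (h (-1) - G.eval (-1)) := by
    have h1 := hQ.exact G c hG.natDegree_le hc
    have h2 : c 0 * D.card - G.eval 1 = D.card * ∑ i, γ i * G.eval (β i) := by
      rw [h1]; field_simp; ring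
    rw [h2, Fin.sum_univ_succ, Fin.sum_univ_succ, hQ.zero_node]
    simp only [hG.eval_node]
    ring
  have hMγ : 0 < D.card * γ 0 := mul_pos hMpos (hQ.weight_pos 0)
  refine ⟨?_, ?_, fun hs => ?_⟩
  · refine le_iInf₂ fun D' hD' => ?_
    rw [EReal.coe_le_coe_iff, ← hD'.2]
    exact le_energy_of_le hn hD'.1 hc fun u hu v hv huv =>
      hGle (ip_mem_Ico huv) (designMinIp_le hD' hu hv huv)
  · have h1 : h (-1) - G.eval (-1) ≤ 0 := by
      rw [he]
      exact mul_nonpos_of_nonneg_of_nonpos (div_nonneg (hnonneg hξ) hfac.le) hW.le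
    rw [hdiff]
    linarith [mul_nonpos_of_nonneg_of_nonpos hMγ.le h1]
  · have hpos : 0 < iteratedDeriv (2 * k + 1) h ξ := by
      rw [← iteratedDerivWithin_Ico_eq hsm _ hξ]
      exact hs.2 _ _ (Set.Ioo_subset_Ico_self hξ)
    have h1 : h (-1) - G.eval (-1) < 0 := by
      rw [he]
      exact mul_neg_of_pos_of_neg (div_pos hpos hfac) hW
    rw [hdiff]
    linarith [mul_neg_of_pos_of_neg hMγ h1]
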